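/- Let $N\ge 1$, $a>0$, $\lambda\in\mathbb{N}_0$, and let $\mu_1,\dots,\mu_N>0$ satisfy $$\Big(\frac{\mu_j}{\mu_k}\Big)^2=a^{k-j}\,\frac{(N-k)!}{(N-j)!}\quad(1\le j,k\le N),\qquad\text{and put}\quad \delta_k^{(\lambda)}=\Big(\frac a2\Big)^{\lambda}\frac{(\lambda+k-1)!}{(k-1)!}.$$ Let $A$ be the $N\times N$ matrix with $A_{k+1,k}=\mu_{k+1}/\mu_k$ and all other entries $0$, let $T^{(\lambda)}=\mathrm{diag}(\delta^{(\lambda)}_1,\dots,\delta^{(\lambda)}_N)$, $J=\mathrm{diag}(1,\dots,N)$, and consider the matrix weight on $\mathbb{N}_0$ $$W^{(\lambda)}(x)=\frac{a^x}{x!}(I+A)^{x+\lambda}\,T^{(\lambda)}\,(I+A^*)^{x+\lambda}.$$ Let $L_0=L(0)$, where $L(x)_{j,k}=\frac{\mu_j}{\mu_k}(-a)^{j-k}\frac{c^{(a)}_{j-k}(x)}{(j-k)!}$ for $j\ge k$ and $L(x)_{j,k}=0$ for $j<k$, with the scalar Charlier polynomials $c_n^{(a)}(x)={}_2F_0(-n,-x;-;-1/a)$.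 Let $\mathcal{D}_n^{(\lambda)}$ ($n\in\mathbb{N}_0$) be the diagonal matrix with entries $$(\mathcal{D}_n^{(\lambda)})_{jj}=(-1)^j e^a\, n!\,a^n\Big(\frac a2\Big)^{\lambda}\frac{(\lambda+N-j)!}{(j-1)!}\,\frac{(-N-\lambda-n)_j}{(\lambda+n+1)_{N-j+1}},$$ where $(z)_m=z(z+1)\cdots(z+m-1)$, and let $\mathcal{A}_{\lambda}=(N+\lambda-J)^{-1}JA^*$. Then there is a unique sequence $(P_n^{(\lambda)})_{n\ge0}$ of polynomials with coefficients in $M_N(\mathbb{C})$ such that $P^{(\lambda)}_n$ is monic of degree $n$ and $\sum_{x=0}^\infty P^{(\lambda)}_m(x)W^{(\lambda)}(x)P^{(\lambda)}_n(x)^*=\delta_{m,n}\mathcal{H}^{(\lambda)}_m$ with $\mathcal{H}^{(\lambda)}_m$ positive definite, and $\mathcal{D}^{(\lambda)}_n$ is the diagonal factor of the square norm: $$\mathcal{H}_n^{(\lambda)}=L_0^{-1}(I+A)^{n+\lambda}\,\mathcal{D}_n^{(\lambda)}\,(I+A^*)^{n+\lambda}(L_0^*)^{-1}\qquad(n\ge0).$$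 These polynomials satisfy a three-term recurrence $xP^{(\lambda)}_n(x)=P^{(\lambda)}_{n+1}(x)+B^{(\lambda)}_nP^{(\lambda)}_n(x)+C^{(\lambda)}_nP^{(\lambda)}_{n-1}(x)$ ($n\ge 0$, $P^{(\lambda)}_{-1}=0$), and its coefficients are, for $n\ge1$, $$C_n^{(\lambda)}=L_0^{-1}(I+A)^{n+\lambda}\mathcal{D}_n^{(\lambda)}(I+A^*)(\mathcal{D}_{n-1}^{(\lambda)})^{-1}(I+A)^{-n-\lambda+1}L_0,$$ and, for $n\ge0$, $$B_n^{(\lambda)}=a\,L_0^{-1}(I+A)^{n+\lambda}\Big((n+1)(I+A)\mathcal{A}_{n+\lambda+1}-n\,\mathcal{A}_{n+\lambda}(I+A)+I+A+\frac na I\Big)(I+A)^{-\lambda-n}L_0,$$ where for $n=0$ the term $n\,\mathcal{A}_{n+\lambda}(I+A)$ is read as $0$. Moreover, there is a unique $N\times N$ matrix of rational functions of $n$ that has no poles at the integers $n\ge1$ and takes the value $C_n^{(\lambda)}$ at every integer $n\ge1$; it is regular at $n=0$ and vanishes there, that is, $C^{(\lambda)}_n$ extends to a unique rational function of $n$, and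 $C_0^{(\lambda)}=0$. -/

import Mathlib

open scoped ComplexOrder

namespace MatrixCharlier

noncomputable section

/-! Rows and columns are indexed by `Fin N`; the index `i : Fin N` stands for the mathematical
index `i + 1 ∈ {1, …, N}`. -/

/-- Complex `N × N` matrices. -/
abbrev Mat (N : ℕ) : Type := Matrix (Fin N) (Fin N) ℂ

/-- `P` is the sequence of monic matrix valued orthogonal polynomials for the weight
`W : ℕ → M_N(ℂ)` supported on `ℕ`, and `H` is the sequence of its square norms:
`P n` is monic of degree `n`, and `∑_{x ≥ 0} P m (x) W(x) (P n (x))ᴴ` converges to `H m` if `m = n`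
and to `0` otherwise, with `H m` positive definite.
The polynomial variable is central, and `P(x)` is the value of `P` at the scalar matrix `x`. -/
structure IsMonicOrthogonal {N : ℕ} (W : ℕ → Mat N) (P : ℕ → Polynomial (Mat N))
    (H : ℕ → Mat N) : Prop where
  monic : ∀ n, (P n).Monic
  natDegree_eq : ∀ n, (P n).natDegree = n
  orthogonal : ∀ m n, HasSum
    (fun x : ℕ => (P m).eval (x : Mat N) * W x * ((P n).eval (x : Mat N)).conjTranspose)
    (if m = n then H m else 0)
  posDef : ∀ n, (H n).PosDef

/-- The three-term recurrence `x P_n = P_{n+1} + B_n P_n + C_n P_{n-1}` for all `n ≥ 0`, with the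
convention `P_{-1} = 0` (so that `C_0` does not occur). -/
structure IsThreeTermRecurrence {N : ℕ} (P : ℕ → Polynomial (Mat N)) (B C : ℕ → Mat N) :
    Prop where
  zero : Polynomial.X * P 0 = P 1 + Polynomial.C (B 0) * P 0
  succ : ∀ n, Polynomial.X * P (n + 1) =
    P (n + 2) + Polynomial.C (B (n + 1)) * P (n + 1) + Polynomial.C (C (n + 1)) * P n

/-- The condition `(μ_j / μ_k)² = a^{k-j} (N-k)! / (N-j)!`, `1 ≤ j, k ≤ N`, on the parameters
`μ_1, …, μ_N`. -/
def MuCondition {N : ℕ} (a : ℝ) (μ : Fin N → ℝ) : Prop :=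
  ∀ j k : Fin N, (μ j / μ k) ^ 2 =
    a ^ ((k : ℤ) - (j : ℤ)) *
      (((N - (k + 1 : ℕ)).factorial : ℝ) / ((N - (j + 1 : ℕ)).factorial : ℝ))

/-- The parameter `δ_k^{(lam)} = (a/2)^lam (lam + k - 1)! / (k - 1)!`, with `k = i + 1`. -/
def delta (a : ℝ) (lam i : ℕ) : ℝ :=
  (a / 2) ^ lam * (((lam + i).factorial : ℝ) / (i.factorial : ℝ))

/-- The subdiagonal matrix `A` with `A_{k+1,k} = μ_{k+1} / μ_k`. -/
def matA {N : ℕ} (μ : Fin N → ℝ) : Mat N :=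
  Matrix.of fun j k => if (j : ℕ) = k + 1 then ((μ j / μ k : ℝ) : ℂ) else 0

/-- `T^{(lam)} = diag(δ_1^{(lam)}, …, δ_N^{(lam)})`. -/
def matT (N : ℕ) (a : ℝ) (lam : ℕ) : Mat N :=
  Matrix.diagonal fun i => ((delta a lam i : ℝ) : ℂ)

/-- `J = diag(1, …, N)`. -/
def matJ (N : ℕ) : Mat N := Matrix.diagonal fun i => (((i : ℕ) + 1 : ℕ) : ℂ)

/-- The weight `W^{(lam)}(x) = a^x / x! (I+A)^{x+lam} T^{(lam)} (I+A^*)^{x+lam}`, `x ∈ ℕ`. -/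
def weight {N : ℕ} (a : ℝ) (μ : Fin N → ℝ) (lam : ℕ) (x : ℕ) : Mat N :=
  ((a ^ x / (x.factorial : ℝ) : ℝ) : ℂ) •
    ((1 + matA μ) ^ (x + lam) * matT N a lam * (1 + (matA μ).conjTranspose) ^ (x + lam))

/-- The scalar Charlier polynomial
`c_n^{(a)}(x) = ₂F₀(-n, -x; -; -1/a) = ∑_k (-n)_k (-x)_k / k! (-1/a)^k`. -/
def charlier (a : ℝ) (n : ℕ) (x : ℂ) : ℂ :=
  ∑ k ∈ Finset.range (n + 1),
    (ascPochhammer ℂ k).eval (-(n : ℂ)) * (ascPochhammer ℂ k).eval (-x) / (k.factorial : ℂ) *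
      (-1 / (a : ℂ)) ^ k

/-- The lower triangular matrix polynomial
`L(x)_{j,k} = μ_j / μ_k (-a)^{j-k} c_{j-k}^{(a)}(x) / (j-k)!` for `j ≥ k`. -/
def matL {N : ℕ} (a : ℝ) (μ : Fin N → ℝ) (x : ℂ) : Mat N :=
  Matrix.of fun j k =>
    if k ≤ j then
      ((μ j / μ k : ℝ) : ℂ) * (-(a : ℂ)) ^ ((j : ℕ) - (k : ℕ)) *
        charlier a ((j : ℕ) - (k : ℕ)) x / ((((j : ℕ) - (k : ℕ)).factorial : ℕ) : ℂ)
    else 0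

/-- `L_0 = L(0)`. -/
def matL0 {N : ℕ} (a : ℝ) (μ : Fin N → ℝ) : Mat N := matL a μ 0

/-- The diagonal matrix `D_n^{(lam)}` with entries (for `j = i + 1`)
`(-1)^j e^a n! a^n (a/2)^lam (lam+N-j)! / (j-1)! (-N-lam-n)_j / (lam+n+1)_{N-j+1}`. -/
def matD (N : ℕ) (a : ℝ) (lam n : ℕ) : Mat N :=
  Matrix.diagonal fun i =>
    (((-1) ^ ((i : ℕ) + 1) * Real.exp a * (n.factorial : ℝ) * a ^ n * (a / 2) ^ lam *
      (((lam + N - ((i : ℕ) + 1)).factorial : ℝ) / ((i : ℕ).factorial : ℝ)) *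
      ((ascPochhammer ℝ ((i : ℕ) + 1)).eval (-(N : ℝ) - lam - n) /
        (ascPochhammer ℝ (N - (i : ℕ))).eval ((lam : ℝ) + n + 1)) : ℝ) : ℂ)

/-- `𝒜_lam = (N + lam - J)⁻¹ J A^*`; the inverse is a genuine one as soon as `lam ≥ 1`. -/
def calA {N : ℕ} (μ : Fin N → ℝ) (lam : ℕ) : Mat N :=
  (((N + lam : ℕ) : Mat N) - matJ N)⁻¹ * matJ N * (matA μ).conjTranspose

/-- The claimed value of `C_n^{(lam)}`, `n ≥ 1`:
`L_0⁻¹ (I+A)^{n+lam} D_n (I+A^*) D_{n-1}⁻¹ (I+A)^{-n-lam+1} L_0`. -/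
def formulaC {N : ℕ} (a : ℝ) (μ : Fin N → ℝ) (lam n : ℕ) : Mat N :=
  (matL0 a μ)⁻¹ * (1 + matA μ) ^ (n + lam) * matD N a lam n * (1 + (matA μ).conjTranspose) *
    (matD N a lam (n - 1))⁻¹ * (1 + matA μ) ^ (-(n : ℤ) - (lam : ℤ) + 1) * matL0 a μ

/-- The claimed value of `B_n^{(lam)}`, `n ≥ 0`:
`a L_0⁻¹ (I+A)^{n+lam} ((n+1)(I+A)𝒜_{n+lam+1} - n 𝒜_{n+lam}(I+A) + I + A + n/a) (I+A)^{-lam-n} L_0`.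
For `n = 0` the second summand is `0`. -/
def formulaB {N : ℕ} (a : ℝ) (μ : Fin N → ℝ) (lam n : ℕ) : Mat N :=
  (a : ℂ) •
    ((matL0 a μ)⁻¹ * (1 + matA μ) ^ (n + lam) *
      (((n : ℂ) + 1) • ((1 + matA μ) * calA μ (n + lam + 1))
        - (n : ℂ) • (calA μ (n + lam) * (1 + matA μ))
        + 1 + matA μ + ((n : ℂ) / (a : ℂ)) • (1 : Mat N)) *
      (1 + matA μ) ^ (-(lam : ℤ) - (n : ℤ)) * matL0 a μ)

/-- The matrix `R` of rational functions is regular at `z` (no entry has a pole) and takes the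
value `V` there. -/
def HasValueAt {N : ℕ} (R : Matrix (Fin N) (Fin N) (RatFunc ℂ)) (z : ℂ) (V : Mat N) : Prop :=
  ∀ i j, (R i j).denom.eval z ≠ 0 ∧ (R i j).eval (RingHom.id ℂ) z = V i j

end

end MatrixCharlier

/-! The proof is a ladder in `λ`. Write `F = J A^*`, `U = (I+A)⁻¹`. The condition on `μ` gives
`[A,F] = H` with `H` diagonal and affine in `J`; together with `[J,A] = A` and `[A,H] = -(2/a)A`,
conjugation by `(I+A)^y` changes `J` by a term linear in `y` and `F` by one quadratic in `y`. With
the two factorizations of `T^{(λ+1)}` this yields Pearson equations `Φ(x) W^{(λ)}(x) = W^{(λ+1)}(x)`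
and `Ψ(x+1) W^{(λ)}(x+1) = W^{(λ+1)}(x)`, where `Φ`, `Ψ` are quadratic with the same leading
coefficient and `Ψ(0) = 0` (`Phi_mul_weight`, `Psi_mul_weight`).

Summation by parts then gives two adjoint relations. The map `P ↦ PΦ - P(x-1)Ψ` carries
`P_n^{(λ+1)}` to `K_n P_{n+1}^{(λ)}`, with `K_n H_{n+1}^{(λ)} = -(n+1) H_n^{(λ+1)}`
(`IsOrthogonal.raise`); the forward difference of `P_{n+1}^{(λ)}` is `(n+1) P_n^{(λ+1)}`
(`IsOrthogonal.shift_sub`). The matrix `g = e^{aA}(I+A)^{n+1+λ}` diagonalizes `K_n`, and `L₀⁻¹ =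
e^{aA}`, so the norm formula follows by induction on `n`, for all `λ` at once, from a scalar
identity for `D_n` and the case `n = 0`. That case is `∑ W(x)`: the operator `Y ↦ (I+A)Y(I+A^*)` is
unipotent, its Poisson average is an exponential of commuting nilpotents, and a Vandermonde sum
evaluates the diagonal part (`hasSum_conj_pow`, `matD_zero`).

In the recurrence `C_n = H_n H_{n-1}⁻¹`, while `B_n` is a difference of subleading coefficients. The
difference relation reduces these to the constant coefficient of `P_1^{(λ+n)}`, which is
`K_0⁻¹Φ(0)`.

For the rational extension, powers of unipotent matrices are polynomial in the exponent, and
`D_n(I+A^*)D_{n-1}⁻¹` is `n` times a matrix of rational functions regular on `ℕ`. Two rational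
functions agreeing at all `n ≥ 1` are equal. -/

namespace MatrixCharlier

noncomputable section

open Polynomial

/-! ### Evaluation, shifts and the raising operator over a noncommutative ring -/

section Shift

variable {R : Type*} [Ring R]

/-- Evaluation of polynomials over a noncommutative ring at a natural number. -/
def evalNat (x : ℕ) : R[X] →+* R :=
  eval₂RingHom' (RingHom.id R) (x : R) fun r => (Nat.cast_commute x r).symm

theorem evalNat_apply (x : ℕ) (P : R[X]) : evalNat x P = P.eval (x : R) := rfl

@[simp] theorem evalNat_C (x : ℕ) (r : R) : evalNat x (C r) = r := by
  simp [evalNat_apply]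

@[simp] theorem evalNat_X (x : ℕ) : evalNat x (X : R[X]) = x := by
  simp [evalNat_apply]

/-- The substitution `X ↦ X + s` for polynomials over a noncommutative ring. -/
def shift (s : ℤ) : R[X] →+* R[X] :=
  eval₂RingHom' C (X + C (s : R)) fun r => by
    refine Commute.add_right (X_mul_C r).symm ?_
    rw [commute_iff_eq, ← C_mul, ← C_mul, (Int.cast_commute s r).eq]

@[simp] theorem shift_C (s : ℤ) (r : R) : shift s (C r) = C r := by
  simp [shift]

@[simp] theorem shift_X (s : ℤ) : shift s (X : R[X]) = X + C (s : R) := by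
  simp [shift]

theorem evalNat_shift_one (x : ℕ) (P : R[X]) :
    evalNat x (shift 1 P) = evalNat (x + 1) P := by
  have h : (evalNat x).comp (shift 1) = evalNat (R := R) (x + 1) :=
    Polynomial.ringHom_ext (by simp) (by simp)
  exact congrArg (fun f => f P) h

theorem evalNat_succ_shift_neg_one (x : ℕ) (P : R[X]) :
    evalNat (x + 1) (shift (-1) P) = evalNat x P := by
  have h : (evalNat (x + 1)).comp (shift (-1)) = evalNat (R := R) x :=
    Polynomial.ringHom_ext (by simp) (by simp)
  exact congrArg (fun f => f P) h

theorem coeff_shift (s : ℤ) {P : R[X]} {n : ℕ} (h : P.natDegree ≤ n) (j : ℕ) :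
    (shift s P).coeff j =
      ∑ k ∈ Finset.range (n + 1), P.coeff k * ((s : R) ^ (k - j) * (k.choose j : R)) := by
  conv_lhs => rw [P.as_sum_range_C_mul_X_pow' (Nat.lt_succ_of_le h)]
  simp only [map_sum, map_mul, map_pow, shift_C, shift_X, finsetSum_coeff, coeff_C_mul,
    coeff_X_add_C_pow]

theorem coeff_shift_of_gt (s : ℤ) {P : R[X]} {n : ℕ} (h : P.natDegree ≤ n) {j : ℕ} (hj : n < j) :
    (shift s P).coeff j = 0 := by
  rw [coeff_shift s h]
  refine Finset.sum_eq_zero fun k hk => ?_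
  rw [Nat.choose_eq_zero_of_lt (by simp at hk; omega)]
  simp

theorem coeff_shift_self (s : ℤ) {P : R[X]} {n : ℕ} (h : P.natDegree ≤ n) :
    (shift s P).coeff n = P.coeff n := by
  rw [coeff_shift s h, Finset.sum_range_succ, Finset.sum_eq_zero]
  · simp
  · intro k hk
    rw [Nat.choose_eq_zero_of_lt (by simpa using hk)]
    simp

theorem coeff_shift_pred (s : ℤ) {P : R[X]} {n : ℕ} (h : P.natDegree ≤ n + 1) :
    (shift s P).coeff n = P.coeff n + P.coeff (n + 1) * (s * (n + 1 : ℕ)) := by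
  rw [coeff_shift s h, Finset.sum_range_succ, Finset.sum_range_succ, Finset.sum_eq_zero]
  · simp
  · intro k hk
    rw [Nat.choose_eq_zero_of_lt (by simpa using hk)]
    simp

theorem coeff_shift_pred_pred (s : ℤ) {P : R[X]} {n : ℕ} (h : P.natDegree ≤ n + 2) :
    (shift s P).coeff n = P.coeff n + P.coeff (n + 1) * (s * (n + 1 : ℕ)) +
      P.coeff (n + 2) * (s ^ 2 * ((n + 2).choose n : ℕ)) := by
  rw [coeff_shift s h, Finset.sum_range_succ, Finset.sum_range_succ, Finset.sum_range_succ,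
    Finset.sum_eq_zero]
  · simp
  · intro k hk
    rw [Nat.choose_eq_zero_of_lt (by simpa using hk)]
    simp

/-- The degree raising operator `P ↦ P Φ - P(X - 1) Ψ`, where the quadratic polynomials
`Φ = f₂ X² + f₁ X + f₀` and `Ψ = f₂ X² + g₁ X` have the same leading coefficient. -/
def raise (f₂ f₁ f₀ g₁ : R) (P : R[X]) : R[X] :=
  P * (C f₂ * X ^ 2 + C f₁ * X + C f₀) - shift (-1) P * (C f₂ * X ^ 2 + C g₁ * X)

theorem coeff_raise (f₂ f₁ f₀ g₁ : R) (P : R[X]) (j : ℕ) :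
    (raise f₂ f₁ f₀ g₁ P).coeff (j + 2) =
      (P.coeff j - (shift (-1) P).coeff j) * f₂ + P.coeff (j + 1) * f₁ -
        (shift (-1) P).coeff (j + 1) * g₁ + P.coeff (j + 2) * f₀ := by
  rw [raise, mul_add, mul_add, mul_add, ← mul_assoc, ← mul_assoc, ← mul_assoc, ← mul_assoc]
  simp only [coeff_sub, coeff_add, coeff_mul_X_pow, coeff_mul_C, coeff_mul_X]
  noncomm_ring

theorem coeff_raise_one (f₂ f₁ f₀ g₁ : R) (P : R[X]) :
    (raise f₂ f₁ f₀ g₁ P).coeff 1 =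
      P.coeff 0 * f₁ - (shift (-1) P).coeff 0 * g₁ + P.coeff 1 * f₀ := by
  rw [raise, mul_add, mul_add, mul_add, ← mul_assoc, ← mul_assoc, ← mul_assoc, ← mul_assoc]
  simp [coeff_sub, coeff_add, coeff_mul_X_pow', coeff_mul_C, coeff_mul_X]
  noncomm_ring

/-- A shift preserves the top coefficient and both quadratics have leading coefficient `f₂`, so the
terms of degree `n + 2` cancel. -/
theorem natDegree_raise_le (f₂ f₁ f₀ g₁ : R) {P : R[X]} {n : ℕ} (h : P.natDegree ≤ n) :
    (raise f₂ f₁ f₀ g₁ P).natDegree ≤ n + 1 := by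
  refine natDegree_le_iff_coeff_eq_zero.2 fun j hj => ?_
  obtain ⟨j, rfl⟩ : ∃ i, j = i + 2 := ⟨j - 2, by omega⟩
  have hP : ∀ i, n < i → P.coeff i = 0 := fun i hi => coeff_eq_zero_of_natDegree_lt (by omega)
  have hS : ∀ i, n < i → (shift (-1) P).coeff i = 0 := fun i hi => coeff_shift_of_gt _ h hi
  rw [coeff_raise, hP (j + 1) (by omega), hP (j + 2) (by omega), hS (j + 1) (by omega)]
  rcases eq_or_lt_of_le (show n ≤ j by omega) with rfl | hj'
  · rw [coeff_shift_self _ h]; simp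
  · rw [hP j hj', hS j hj']; simp

/-- The term `n * f₂` comes from the difference `P - P(X - 1)`, whose coefficient in degree `n - 1`
is `n` times the top coefficient of `P`. -/
theorem coeff_raise_top (f₂ f₁ f₀ g₁ : R) {P : R[X]} {n : ℕ} (h : P.natDegree ≤ n) :
    (raise f₂ f₁ f₀ g₁ P).coeff (n + 1) = P.coeff n * (n * f₂ + f₁ - g₁) := by
  have hP : P.coeff (n + 1) = 0 := coeff_eq_zero_of_natDegree_lt (by omega)
  cases n with
  | zero =>
    rw [coeff_raise_one, coeff_shift_self _ h, hP]
    simp [mul_sub]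
  | succ n =>
    rw [coeff_raise, coeff_shift_self _ h, coeff_shift_pred _ h, hP]
    push_cast
    noncomm_ring

theorem coeff_zero_raise_one (f₂ f₁ f₀ g₁ : R) :
    (raise f₂ f₁ f₀ g₁ 1).coeff 0 = f₀ := by
  simp [raise]

/-- `Ψ` has no constant term. This is the boundary condition at `0` that matches the extension by
zero in `nabla`. -/
theorem evalNat_raise_zero (f₂ f₁ f₀ g₁ : R) (P : R[X]) :
    evalNat 0 (raise f₂ f₁ f₀ g₁ P) = evalNat 0 P * f₀ := by
  simp [raise]

theorem evalNat_raise_succ (f₂ f₁ f₀ g₁ : R) (P : R[X]) (x : ℕ) :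
    evalNat (x + 1) (raise f₂ f₁ f₀ g₁ P) =
      evalNat (x + 1) P * (f₂ * (x + 1) ^ 2 + f₁ * (x + 1) + f₀) -
        evalNat x P * (f₂ * (x + 1) ^ 2 + g₁ * (x + 1)) := by
  simp [raise, evalNat_succ_shift_neg_one]

end Shift

/-! ### Moments, orthogonality, uniqueness and summation by parts -/

section Moments

variable {N : ℕ}

theorem hasSum_of_eq {α : Type*} [AddCommMonoid α] [TopologicalSpace α] {f g : ℕ → α} {s : α}
    (h : HasSum f s) (e : ∀ x, g x = f x) :
    HasSum g s :=
  (funext e : g = f) ▸ h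

theorem evalNat_eq_sum {P : (Mat N)[X]} {n : ℕ} (h : P.natDegree ≤ n) (x : ℕ) :
    evalNat x P = ∑ k ∈ Finset.range (n + 1), (x : ℂ) ^ k • P.coeff k := by
  rw [evalNat_apply, eval_eq_sum_range' (Nat.lt_succ_of_le h)]
  refine Finset.sum_congr rfl fun k _ => ?_
  rw [← Nat.cast_pow, ← Nat.cast_pow, Nat.cast_smul_eq_nsmul, nsmul_eq_mul,
    (Nat.cast_commute _ _).eq]

/-- `m k` is the `k`-th moment `∑ x ^ k f(x)` of the matrix valued function `f`. -/
def HasMoments (f m : ℕ → Mat N) : Prop :=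
  ∀ k, HasSum (fun x : ℕ => (x : ℂ) ^ k • f x) (m k)

theorem hasSum_mul_conjTranspose_evalNat {f m : ℕ → Mat N} {Q : (Mat N)[X]} {n : ℕ}
    (hQ : Q.natDegree ≤ n) (h : ∀ k ≤ n, HasSum (fun x : ℕ => (x : ℂ) ^ k • f x) (m k)) :
    HasSum (fun x : ℕ => f x * (evalNat x Q).conjTranspose)
      (∑ k ∈ Finset.range (n + 1), m k * (Q.coeff k).conjTranspose) := by
  have := hasSum_sum (s := Finset.range (n + 1)) fun k hk =>
    (h k (by simp at hk; omega)).mul_right (Q.coeff k).conjTranspose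
  refine hasSum_of_eq this fun x => ?_
  rw [evalNat_eq_sum hQ, Matrix.conjTranspose_sum, Finset.mul_sum]
  refine Finset.sum_congr rfl fun k _ => ?_
  simp

theorem HasMoments.evalNat_mul {W m : ℕ → Mat N} (h : HasMoments W m) (P : (Mat N)[X]) :
    HasMoments (fun x => evalNat x P * W x)
      (fun j => ∑ i ∈ Finset.range (P.natDegree + 1), P.coeff i * m (i + j)) := by
  intro j
  have := hasSum_sum (s := Finset.range (P.natDegree + 1)) fun i _ =>
    (h (i + j)).mul_left (P.coeff i)
  refine hasSum_of_eq this fun x => ?_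
  dsimp only
  rw [evalNat_eq_sum le_rfl, Finset.sum_mul, Finset.smul_sum]
  refine Finset.sum_congr rfl fun i _ => ?_
  rw [Matrix.smul_mul, Matrix.mul_smul, smul_smul, ← pow_add, add_comm]

/-- `P` is monic of degree `n`, orthogonal to all polynomials of lower degree with respect to the
weight `W`, and `H = ∑ x ^ n P(x) W(x)`. -/
structure IsOrthogonal (W : ℕ → Mat N) (P : (Mat N)[X]) (n : ℕ) (H : Mat N) : Prop where
  monic : P.Monic
  natDegree_eq : P.natDegree = n
  moment_lt : ∀ m < n, HasSum (fun x : ℕ => (x : ℂ) ^ m • (evalNat x P * W x)) 0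
  moment_self : HasSum (fun x : ℕ => (x : ℂ) ^ n • (evalNat x P * W x)) H

theorem IsOrthogonal.coeff_self {W : ℕ → Mat N} {P : (Mat N)[X]} {n : ℕ} {H : Mat N}
    (h : IsOrthogonal W P n H) : P.coeff n = 1 := by
  have := h.monic.coeff_natDegree
  rwa [h.natDegree_eq] at this

theorem hasSum_zero_of_moments_zero {W : ℕ → Mat N} {R Q : (Mat N)[X]} {n : ℕ}
    (h : ∀ m < n, HasSum (fun x : ℕ => (x : ℂ) ^ m • (evalNat x R * W x)) 0)
    (hQ : Q.natDegree < n) :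
    HasSum (fun x : ℕ => evalNat x R * W x * (evalNat x Q).conjTranspose) 0 := by
  have := hasSum_mul_conjTranspose_evalNat (f := fun x => evalNat x R * W x) (m := 0)
    (le_refl Q.natDegree) fun k hk => h k (by omega)
  simpa using this

/-- Only the coefficient of `X ^ n` in `Q` meets a nonzero moment. For `Q = P` this shows that the
one-sided moment `H` is the square norm. -/
theorem IsOrthogonal.hasSum_mul {W : ℕ → Mat N} {P Q : (Mat N)[X]} {n : ℕ} {H : Mat N}
    (h : IsOrthogonal W P n H) (hQ : Q.natDegree ≤ n) :
    HasSum (fun x : ℕ => evalNat x P * W x * (evalNat x Q).conjTranspose)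
      (H * (Q.coeff n).conjTranspose) := by
  have := hasSum_mul_conjTranspose_evalNat (f := fun x => evalNat x P * W x)
    (m := fun k => if k = n then H else 0) hQ fun k hk => by
      rcases eq_or_lt_of_le hk with rfl | hk
      · simpa using h.moment_self
      · simpa [hk.ne] using h.moment_lt k hk
  rw [Finset.sum_eq_single n] at this
  · simpa using this
  · intro b _ hb
    simp [hb]
  · simp

theorem hasSum_conjTranspose_swap {W : ℕ → Mat N} (hW : ∀ x, (W x).IsHermitian)
    {P Q : (Mat N)[X]} {S : Mat N}
    (h : HasSum (fun x : ℕ => evalNat x P * W x * (evalNat x Q).conjTranspose) S) :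
    HasSum (fun x : ℕ => evalNat x Q * W x * (evalNat x P).conjTranspose) S.conjTranspose := by
  refine hasSum_of_eq h.matrix_conjTranspose fun x => ?_
  simp [Matrix.conjTranspose_mul, (hW x).eq, mul_assoc]

/-- Pairing `R ≠ 0` with the `P k` of its own degree gives `H k` times the adjoint of the leading
coefficient of `R`. As `H k` is invertible this is nonzero, even when the leading coefficient is
singular. -/
theorem IsOrthogonal.eq_zero_of_hasSum {W : ℕ → Mat N} {P : ℕ → (Mat N)[X]} {H : ℕ → Mat N}
    (hW : ∀ x, (W x).IsHermitian) (hH : ∀ n, (H n).PosDef)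
    (h : ∀ n, IsOrthogonal W (P n) n (H n)) {R : (Mat N)[X]} {n : ℕ}
    (hR : ∀ j, n ≤ j → R.coeff j = 0)
    (h0 : ∀ k < n,
      HasSum (fun x : ℕ => evalNat x R * W x * (evalNat x (P k)).conjTranspose) 0) :
    R = 0 := by
  by_contra hne
  have hlt : R.natDegree < n := by
    by_contra hge
    exact leadingCoeff_ne_zero.2 hne (hR _ (not_lt.1 hge))
  have h1 := hasSum_conjTranspose_swap hW (h0 _ hlt)
  have h2 := ((h R.natDegree).hasSum_mul le_rfl).unique h1
  rw [Matrix.conjTranspose_zero] at h2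
  have h3 := (hH R.natDegree).isUnit.mul_right_eq_zero.1 h2
  exact leadingCoeff_ne_zero.2 hne (by simpa using h3)

theorem IsOrthogonal.eq_zero_of_moments {W : ℕ → Mat N} {P : ℕ → (Mat N)[X]} {H : ℕ → Mat N}
    (hW : ∀ x, (W x).IsHermitian) (hH : ∀ n, (H n).PosDef)
    (h : ∀ n, IsOrthogonal W (P n) n (H n)) {R : (Mat N)[X]} {n : ℕ}
    (hR : ∀ j, n ≤ j → R.coeff j = 0)
    (h0 : ∀ m < n, HasSum (fun x : ℕ => (x : ℂ) ^ m • (evalNat x R * W x)) 0) :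
    R = 0 :=
  eq_zero_of_hasSum hW hH h hR fun k hk =>
    hasSum_zero_of_moments_zero h0 (by rw [(h k).natDegree_eq]; exact hk)

theorem IsOrthogonal.isMonicOrthogonal {W : ℕ → Mat N} {P : ℕ → (Mat N)[X]} {H : ℕ → Mat N}
    (hW : ∀ x, (W x).IsHermitian) (hH : ∀ n, (H n).PosDef)
    (h : ∀ n, IsOrthogonal W (P n) n (H n)) : IsMonicOrthogonal W P H where
  monic n := (h n).monic
  natDegree_eq n := (h n).natDegree_eq
  posDef := hH
  orthogonal m n := by
    have key : ∀ m n, n < m → HasSum (fun x : ℕ =>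
        evalNat x (P m) * W x * (evalNat x (P n)).conjTranspose) 0 := fun m n hlt =>
      hasSum_zero_of_moments_zero (h m).moment_lt (by rw [(h n).natDegree_eq]; exact hlt)
    rcases lt_trichotomy m n with hlt | rfl | hlt
    · rw [if_neg hlt.ne]
      simpa [evalNat_apply] using hasSum_conjTranspose_swap hW (key n m hlt)
    · have := (h m).hasSum_mul (h m).natDegree_eq.le
      rw [(h m).coeff_self] at this
      simpa [evalNat_apply] using this
    · rw [if_neg hlt.ne']
      exact key m n hlt

/-- By strong induction: the difference of two monic candidates has degree below `n` and is
orthogonal to every `P k`, `k < n`, because these already coincide with the `P' k`. -/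
theorem IsMonicOrthogonal.eq_of_isOrthogonal {W : ℕ → Mat N} {P P' : ℕ → (Mat N)[X]}
    {H H' : ℕ → Mat N} (hW : ∀ x, (W x).IsHermitian) (hH : ∀ n, (H n).PosDef)
    (h : ∀ n, IsOrthogonal W (P n) n (H n)) (h' : IsMonicOrthogonal W P' H') :
    P' = P ∧ H' = H := by
  have hP : ∀ n, P' n = P n := by
    intro n
    induction n using Nat.strong_induction_on with
    | _ n ih =>
      refine sub_eq_zero.1 (IsOrthogonal.eq_zero_of_hasSum hW hH h (n := n) ?_ ?_)
      · intro j hj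
        rcases eq_or_lt_of_le hj with rfl | hj
        · have := (h'.monic n).coeff_natDegree
          rw [h'.natDegree_eq] at this
          rw [coeff_sub, this, (h n).coeff_self, sub_self]
        · rw [coeff_sub, coeff_eq_zero_of_natDegree_lt (by rw [h'.natDegree_eq]; exact hj),
            coeff_eq_zero_of_natDegree_lt (by rw [(h n).natDegree_eq]; exact hj), sub_self]
      · intro k hk
        have h1 := h'.orthogonal n k
        have h2 := (IsOrthogonal.isMonicOrthogonal hW hH h).orthogonal n k
        rw [if_neg hk.ne'] at h1 h2
        rw [ih k hk] at h1
        simpa [evalNat_apply, map_sub, sub_mul] using h1.sub h2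
  have hPP : P' = P := funext hP
  refine ⟨hPP, funext fun n => ?_⟩
  have h1 := h'.orthogonal n n
  have h2 := (IsOrthogonal.isMonicOrthogonal hW hH h).orthogonal n n
  rw [hPP] at h1
  simpa using h1.unique h2

/-- The backward difference of a sequence extended by zero. -/
def nabla (f : ℕ → Mat N) : ℕ → Mat N
  | 0 => f 0
  | x + 1 => f (x + 1) - f x

/-- Summation by parts. No boundary term appears, because `f` is extended by zero and both series
converge. -/
theorem hasSum_mul_nabla {p f : ℕ → Mat N} {s t : Mat N}
    (hs : HasSum (fun x => p x * f x) s) (ht : HasSum (fun x => p (x + 1) * f x) t) :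
    HasSum (fun x => p x * nabla f x) (s - t) := by
  -- The second series reindexed by one, with a zero term put at `x = 0`.
  have h1 : HasSum (fun x : ℕ => match x with
    | 0 => 0
    | x + 1 => p (x + 1) * f x) t := by
    rw [← hasSum_nat_add_iff' 1]
    simpa using ht
  refine hasSum_of_eq (hs.sub h1) fun x => ?_
  cases x <;> simp [nabla, mul_sub]

/-- Since `x ^ j - (x + 1) ^ j` has degree below `j`, only moments of order below `j` of `f` enter.
This is how one degree of orthogonality is gained. -/
theorem HasMoments.nabla {f m : ℕ → Mat N} (h : HasMoments f m) (j : ℕ) :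
    HasSum (fun x : ℕ => (x : ℂ) ^ j • nabla f x)
      (-∑ i ∈ Finset.range j, (j.choose i : ℂ) • m i) := by
  have h1 := hasSum_sum (s := Finset.range (j + 1)) fun i _ =>
    (h i).const_smul (j.choose i : ℂ)
  have h2 := hasSum_mul_nabla (p := fun x => ((x : ℂ) ^ j) • 1) (f := f) (s := m j)
    (t := ∑ i ∈ Finset.range (j + 1), (j.choose i : ℂ) • m i) (by simpa using h j) (by
      refine hasSum_of_eq h1 fun x => ?_
      push_cast
      rw [add_pow, Finset.sum_smul, Finset.sum_mul]
      refine Finset.sum_congr rfl fun i _ => ?_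
      rw [smul_smul]
      simp [mul_comm])
  rw [Finset.sum_range_succ] at h2
  simpa using h2

end Moments

/-! ### Raising and lowering relations and the three-term recurrence -/

section Ladder

variable {N : ℕ}

theorem HasMoments.of_isOrthogonal {W m : ℕ → Mat N} (hm : HasMoments W m) {P : (Mat N)[X]}
    {n : ℕ} {H : Mat N} (h : IsOrthogonal W P n H) :
    ∃ m', HasMoments (fun x => evalNat x P * W x) m' ∧ (∀ k < n, m' k = 0) ∧ m' n = H :=
  ⟨_, hm.evalNat_mul P, fun k hk => (hm.evalNat_mul P k).unique (h.moment_lt k hk),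
    (hm.evalNat_mul P n).unique h.moment_self⟩

theorem nabla_evalNat_mul {W W₁ : ℕ → Mat N} {f₂ f₁ f₀ g₁ : Mat N}
    (hΦ : ∀ x : ℕ, (f₂ * (x : Mat N) ^ 2 + f₁ * x + f₀) * W x = W₁ x)
    (hΨ : ∀ x : ℕ, (f₂ * ((x : Mat N) + 1) ^ 2 + g₁ * (x + 1)) * W (x + 1) = W₁ x)
    (P : (Mat N)[X]) (x : ℕ) :
    nabla (fun x => evalNat x P * W₁ x) x = evalNat x (raise f₂ f₁ f₀ g₁ P) * W x := by
  cases x with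
  | zero =>
    have := hΦ 0
    simp only [Nat.cast_zero, ne_eq, OfNat.ofNat_ne_zero, not_false_eq_true, zero_pow, mul_zero,
      add_zero, zero_add] at this
    rw [evalNat_raise_zero, nabla, ← this, mul_assoc]
  | succ x =>
    rw [evalNat_raise_succ, nabla, ← hΦ (x + 1), ← hΨ x, sub_mul, mul_assoc, mul_assoc]
    push_cast
    rfl

/-- By the Pearson equations the raised polynomial times `W` is `nabla` of `P W₁`, so its moments up
to order `n` vanish. The factor `n + 1` in the new norm is the binomial coefficient of the only
surviving moment. -/
theorem IsOrthogonal.raise [Nontrivial (Mat N)] {W W₁ m : ℕ → Mat N} {f₂ f₁ f₀ g₁ K Ki : Mat N}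
    (hΦ : ∀ x : ℕ, (f₂ * (x : Mat N) ^ 2 + f₁ * x + f₀) * W x = W₁ x)
    (hΨ : ∀ x : ℕ, (f₂ * ((x : Mat N) + 1) ^ 2 + g₁ * (x + 1)) * W (x + 1) = W₁ x)
    (hm : HasMoments W₁ m) {P : (Mat N)[X]} {n : ℕ} {H : Mat N}
    (hK : n * f₂ + f₁ - g₁ = K) (hKi : Ki * K = 1) (h : IsOrthogonal W₁ P n H) :
    IsOrthogonal W (C Ki * raise f₂ f₁ f₀ g₁ P) (n + 1) (Ki * -((n + 1 : ℂ) • H)) := by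
  have htop : (C Ki * MatrixCharlier.raise f₂ f₁ f₀ g₁ P).coeff (n + 1) = 1 := by
    rw [coeff_C_mul, coeff_raise_top _ _ _ _ h.natDegree_eq.le, h.coeff_self, one_mul, hK, hKi]
  have hdeg : (C Ki * MatrixCharlier.raise f₂ f₁ f₀ g₁ P).natDegree = n + 1 := by
    refine natDegree_eq_of_le_of_coeff_ne_zero
      ((natDegree_C_mul_le _ _).trans (natDegree_raise_le _ _ _ _ h.natDegree_eq.le)) ?_
    rw [htop]
    exact one_ne_zero
  obtain ⟨m', hm', hlt, hself⟩ := hm.of_isOrthogonal h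
  have key : ∀ j, HasSum (fun x : ℕ => (x : ℂ) ^ j •
      (evalNat x (C Ki * MatrixCharlier.raise f₂ f₁ f₀ g₁ P) * W x))
      (Ki * -∑ i ∈ Finset.range j, (j.choose i : ℂ) • m' i) := fun j => by
    refine hasSum_of_eq ((hm'.nabla j).mul_left Ki) fun x => ?_
    rw [nabla_evalNat_mul hΦ hΨ, map_mul, evalNat_C, mul_assoc, Matrix.mul_smul]
  refine ⟨?_, hdeg, fun j hj => ?_, ?_⟩
  · rw [Monic, leadingCoeff, hdeg, htop]
  · have := key j
    rwa [Finset.sum_eq_zero fun i hi => by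
      rw [hlt i (by simp at hi; omega), smul_zero], neg_zero, mul_zero] at this
  · have := key (n + 1)
    rw [Finset.sum_range_succ, Finset.sum_eq_zero fun i hi => by
      rw [hlt i (by simpa using hi), smul_zero], zero_add, hself, Nat.choose_succ_self_right] at this
    exact_mod_cast this

/-- Adjoint to raising: testing the forward difference of `P` against `x ^ j` in `W₁` amounts, up to
sign, to testing `P` against the raised `X ^ j` in `W`. The latter has degree at most `j + 1 < n +
1`, so the sum vanishes for `j < n`. -/
theorem IsOrthogonal.shift_sub {W W₁ m : ℕ → Mat N} {f₂ f₁ f₀ g₁ : Mat N}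
    (hΦ : ∀ x : ℕ, (f₂ * (x : Mat N) ^ 2 + f₁ * x + f₀) * W x = W₁ x)
    (hΨ : ∀ x : ℕ, (f₂ * ((x : Mat N) + 1) ^ 2 + g₁ * (x + 1)) * W (x + 1) = W₁ x)
    (hm : HasMoments W₁ m) (hW : ∀ x, (W x).IsHermitian) (hW₁ : ∀ x, (W₁ x).IsHermitian)
    {P₁ : ℕ → (Mat N)[X]} {H₁ : ℕ → Mat N} (hH₁ : ∀ n, (H₁ n).PosDef)
    (h₁ : ∀ n, IsOrthogonal W₁ (P₁ n) n (H₁ n))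
    {P : (Mat N)[X]} {n : ℕ} {H : Mat N} (h : IsOrthogonal W P (n + 1) H) :
    shift 1 P - P = C ((n + 1 : ℕ) : Mat N) * P₁ n := by
  refine sub_eq_zero.1 (eq_zero_of_moments hW₁ hH₁ h₁ (n := n) ?_ ?_)
  · intro j hj
    rw [coeff_sub, coeff_sub, coeff_C_mul]
    have hP := h.natDegree_eq.le
    rcases eq_or_lt_of_le hj with rfl | hj
    · rw [coeff_shift_pred _ hP, h.coeff_self, (h₁ n).coeff_self]
      simp
    · rw [coeff_eq_zero_of_natDegree_lt (p := P₁ n) (by rw [(h₁ n).natDegree_eq]; exact hj)]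
      rcases eq_or_lt_of_le (Nat.succ_le_of_lt hj) with rfl | hj
      · rw [coeff_shift_self _ hP]
        simp
      · rw [coeff_shift_of_gt _ hP hj, coeff_eq_zero_of_natDegree_lt (by omega)]
        simp
  · intro j hj
    have hs := hm.evalNat_mul P j
    have ht := hm.evalNat_mul (shift 1 P) j
    set s := ∑ i ∈ Finset.range (P.natDegree + 1), P.coeff i * m (i + j)
    set t := ∑ i ∈ Finset.range ((shift 1 P).natDegree + 1), (shift 1 P).coeff i * m (i + j)
    have h2 := hasSum_mul_nabla (p := fun x => evalNat x P) (f := fun x => evalNat x (X ^ j) * W₁ x)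
      (s := s) (t := t) (hasSum_of_eq hs fun x => by
        simp [evalNat_eq_sum (natDegree_X_pow_le j), coeff_X_pow])
      (hasSum_of_eq ht fun x => by
        simp [evalNat_eq_sum (natDegree_X_pow_le j), coeff_X_pow, evalNat_shift_one])
    -- Hermitian symmetry lets the Pearson equations, which act from the left, be used on the
    -- right-hand factor.
    have hherm : ∀ x, (nabla (fun x => evalNat x (X ^ j) * W₁ x) x).IsHermitian := by
      have : ∀ x, (evalNat x (X ^ j) * W₁ x).IsHermitian := fun x => by
        rw [map_pow, evalNat_X, ← Nat.cast_pow, Matrix.IsHermitian, Matrix.conjTranspose_mul,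
          Matrix.conjTranspose_natCast, (hW₁ x).eq, (Nat.cast_commute _ _).eq]
      intro x
      cases x with
      | zero => exact this 0
      | succ x => exact (this (x + 1)).sub (this x)
    have h3 := hasSum_zero_of_moments_zero h.moment_lt
      (Q := MatrixCharlier.raise f₂ f₁ f₀ g₁ (X ^ j)) (Nat.lt_succ_of_le <|
        (natDegree_raise_le _ _ _ _ (natDegree_X_pow_le j)).trans (Nat.succ_le_of_lt hj))
    have h4 : s - t = 0 := h2.unique <| hasSum_of_eq h3 fun x => by
      rw [← (hherm x).eq, nabla_evalNat_mul hΦ hΨ, Matrix.conjTranspose_mul, (hW x).eq, mul_assoc]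
    have h5 := (h₁ n).moment_lt j hj
    have h6 := (ht.sub hs).sub (h5.mul_left ((n + 1 : ℕ) : Mat N))
    rw [← neg_sub s t, h4, mul_zero, neg_zero, sub_zero] at h6
    refine hasSum_of_eq h6 fun x => ?_
    simp only [map_sub, map_mul, evalNat_C, sub_mul, smul_sub, Matrix.mul_smul, mul_assoc]

/-- The coefficient of `X ^ n` in `X * P n` is the subleading coefficient of `P n`, and `0` if
`n = 0`. -/
theorem IsOrthogonal.isThreeTermRecurrence {W : ℕ → Mat N}
    (hW : ∀ x, (W x).IsHermitian) {P : ℕ → (Mat N)[X]} {H : ℕ → Mat N} (hH : ∀ n, (H n).PosDef)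
    (h : ∀ n, IsOrthogonal W (P n) n (H n)) :
    IsThreeTermRecurrence P (fun n => (X * P n).coeff n - (P (n + 1)).coeff n)
      (fun n => H n * (H (n - 1))⁻¹) := by
  have hgt : ∀ {n j}, n < j → (P n).coeff j = 0 := fun {n j} hj =>
    coeff_eq_zero_of_natDegree_lt (by rw [(h n).natDegree_eq]; exact hj)
  constructor
  · have h0 : P 0 = 1 := (h 0).monic.natDegree_eq_zero.1 (h 0).natDegree_eq
    rw [← sub_eq_zero]
    refine Polynomial.ext fun j => ?_
    rcases Nat.lt_trichotomy j 1 with hj | rfl | hj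
    · obtain rfl : j = 0 := by omega
      simp [h0]
    · simp [h0, (h 1).coeff_self]
    · have hj0 : j ≠ 0 := by omega
      simp [h0, hgt hj, coeff_X, coeff_C, hj.ne, hj0]
  · intro n
    rw [← sub_eq_zero]
    -- `B` is chosen to cancel the coefficient of `X ^ (n + 1)`, and `C` to cancel the `n`-th
    -- moment; lower moments vanish by orthogonality.
    refine eq_zero_of_moments hW hH h (n := n + 1) ?_ ?_
    · intro j hj
      obtain ⟨j, rfl⟩ : ∃ i, j = i + 1 := ⟨j - 1, by omega⟩
      rw [coeff_sub, coeff_X_mul, coeff_add, coeff_add, coeff_C_mul, coeff_C_mul,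
        hgt (show n < j + 1 by omega), mul_zero, add_zero]
      rcases eq_or_lt_of_le hj with hj | hj
      · obtain rfl : n = j := by omega
        simp [(h (n + 1)).coeff_self]
      · rw [hgt hj, mul_zero, add_zero]
        rcases eq_or_lt_of_le (Nat.succ_le_of_lt hj) with hj | hj
        · obtain rfl : j = n + 1 := by omega
          rw [(h (n + 1)).coeff_self, (h (n + 2)).coeff_self, sub_self]
        · rw [hgt (show n + 1 < j by omega), hgt hj, sub_self]
    · intro j hj
      have hX : HasSum (fun x : ℕ => (x : ℂ) ^ j • (evalNat x (X * P (n + 1)) * W x))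
          (if j = n then H (n + 1) else 0) := by
        have : HasSum (fun x : ℕ => (x : ℂ) ^ (j + 1) • (evalNat x (P (n + 1)) * W x))
          (if j = n then H (n + 1) else 0) := by
          split_ifs with e
          · rw [e]; exact (h (n + 1)).moment_self
          · exact (h (n + 1)).moment_lt _ (by omega)
        refine hasSum_of_eq this fun x => ?_
        rw [map_mul, evalNat_X, mul_assoc, ← nsmul_eq_mul, ← Nat.cast_smul_eq_nsmul ℂ, smul_smul,
          pow_succ]
      have hn : HasSum (fun x : ℕ => (x : ℂ) ^ j • (evalNat x (P n) * W x))
          (if j = n then H n else 0) := by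
        split_ifs with e
        · rw [e]; exact (h n).moment_self
        · exact (h n).moment_lt _ (by omega)
      have h1 := (h (n + 1)).moment_lt j hj
      have h2 := (h (n + 2)).moment_lt j (by omega)
      have := hX.sub ((h2.add (h1.mul_left ((X * P (n + 1)).coeff (n + 1) -
        (P (n + 2)).coeff (n + 1)))).add (hn.mul_left (H (n + 1) * (H n)⁻¹)))
      have e : (if j = n then H (n + 1) else 0) - (0 + ((X * P (n + 1)).coeff (n + 1) -
        (P (n + 2)).coeff (n + 1)) * 0 + H (n + 1) * (H n)⁻¹ * (if j = n then H n else 0)) = 0 := by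
        split_ifs
        · rw [Matrix.nonsing_inv_mul_cancel_right _ _ ((Matrix.isUnit_iff_isUnit_det _).1
            (hH n).isUnit)]
          simp
        · simp
      rw [e] at this
      refine hasSum_of_eq this fun x => ?_
      simp [map_sub, map_add, map_mul, sub_mul, add_mul, smul_sub, smul_add, mul_assoc]

/-- Any recurrence has these coefficients: compare coefficients of `X ^ n` for `B n`, and `n`-th
moments in the equation for `X * P (n + 1)` for `C (n + 1)`. -/
theorem IsThreeTermRecurrence.eq {W : ℕ → Mat N} {P : ℕ → (Mat N)[X]} {H : ℕ → Mat N}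
    (hH : ∀ n, (H n).PosDef) (h : ∀ n, IsOrthogonal W (P n) n (H n)) {B C : ℕ → Mat N}
    (hBC : IsThreeTermRecurrence P B C) :
    (∀ n, B n = (X * P n).coeff n - (P (n + 1)).coeff n) ∧
      ∀ n, C (n + 1) = H (n + 1) * (H n)⁻¹ := by
  have hgt : ∀ {n j}, n < j → (P n).coeff j = 0 := fun {n j} hj =>
    coeff_eq_zero_of_natDegree_lt (by rw [(h n).natDegree_eq]; exact hj)
  constructor
  · rintro (_ | n)
    · rw [hBC.zero]
      simp [(h 0).coeff_self]
    · rw [hBC.succ]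
      simp [(h (n + 1)).coeff_self, hgt (Nat.lt_succ_self n)]
  · intro n
    have hX : HasSum (fun x : ℕ => (x : ℂ) ^ n • (evalNat x (X * P (n + 1)) * W x))
        (H (n + 1)) := by
      refine hasSum_of_eq (h (n + 1)).moment_self fun x => ?_
      rw [map_mul, evalNat_X, mul_assoc, ← nsmul_eq_mul, ← Nat.cast_smul_eq_nsmul ℂ, smul_smul,
        pow_succ]
    have h1 := (h (n + 1)).moment_lt n (by omega)
    have h2 := (h (n + 2)).moment_lt n (by omega)
    have := (h2.add (h1.mul_left (B (n + 1)))).add ((h n).moment_self.mul_left (C (n + 1)))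
    have e := hX.unique (hasSum_of_eq this fun x => by
      simp [hBC.succ, map_add, map_mul, add_mul, smul_add, mul_assoc])
    rw [e, mul_zero, add_zero, zero_add, Matrix.mul_nonsing_inv_cancel_right _ _
      ((Matrix.isUnit_iff_isUnit_det _).1 (hH n).isUnit)]

end Ladder

/-! ### Nilpotent exponentials and Poisson sums -/

section Exponential

theorem exp_smul_eq_sum {R : Type*} [Ring R] [Algebra ℂ R] [Module ℚ R] (c : ℂ) {A : R} {k : ℕ}
    (h : A ^ k = 0) :
    IsNilpotent.exp (c • A) = ∑ i ∈ Finset.range k, (c ^ i / (i.factorial : ℂ)) • A ^ i := by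
  rw [IsNilpotent.exp_eq_sum (k := k) (by rw [_root_.smul_pow, h, smul_zero])]
  refine Finset.sum_congr rfl fun i _ => ?_
  rw [inv_natCast_smul_eq ℚ ℂ, _root_.smul_pow, smul_smul, div_eq_inv_mul]

theorem hasSum_choose_mul_pow_div_factorial (a : ℝ) (k : ℕ) :
    HasSum (fun x : ℕ => a ^ x / (x.factorial : ℝ) * (x.choose k : ℝ))
      (Real.exp a * (a ^ k / (k.factorial : ℝ))) := by
  rw [← hasSum_nat_add_iff' k, Finset.sum_eq_zero fun x hx => by
    rw [Nat.choose_eq_zero_of_lt (by simpa using hx)]; simp, sub_zero]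
  have h : HasSum (fun x : ℕ => a ^ x / (x.factorial : ℝ)) (Real.exp a) := by
    rw [Real.exp_eq_exp_ℝ]
    exact NormedSpace.expSeries_div_hasSum_exp a
  refine hasSum_of_eq (h.mul_right (a ^ k / (k.factorial : ℝ))) fun x => ?_
  rw [← Nat.choose_symm_add, Nat.cast_add_choose, pow_add]
  have := (x + k).factorial_ne_zero
  field_simp

/-- The bounds `x ^ m ≤ m! e ^ x` and `x.choose k ≤ 2 ^ x` leave the exponential series at `2ea`. -/
theorem summable_pow_mul_choose (a : ℝ) (ha : 0 < a) (m k : ℕ) :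
    Summable (fun x : ℕ => (x : ℝ) ^ m * (a ^ x / (x.factorial : ℝ) * (x.choose k : ℝ))) := by
  have hs := (Real.summable_pow_div_factorial (2 * Real.exp 1 * a)).mul_left (m.factorial : ℝ)
  refine Summable.of_nonneg_of_le (fun x => by positivity) (fun x => ?_) hs
  have h1 : (x : ℝ) ^ m ≤ m.factorial * Real.exp 1 ^ x := by
    have := Real.pow_div_factorial_le_exp (x : ℝ) (by positivity) m
    rw [div_le_iff₀ (by positivity)] at this
    rw [← Real.exp_nat_mul, mul_one, mul_comm]
    exact this
  have h2 : (x.choose k : ℝ) ≤ 2 ^ x := by exact_mod_cast Nat.choose_le_two_pow x k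
  calc (x : ℝ) ^ m * (a ^ x / (x.factorial : ℝ) * (x.choose k : ℝ))
      ≤ (m.factorial * Real.exp 1 ^ x) * (a ^ x / (x.factorial : ℝ) * 2 ^ x) := by gcongr
    _ = _ := by rw [mul_pow, mul_pow]; ring

end Exponential

/-! ### Poisson averages of two-sided multiplication by unipotent matrices -/

section Conjugation

variable {N : ℕ}

open LinearMap

/-- The operator `Y ↦ (1 + A) Y (1 + E) - Y`. -/
def conjSub (A E : Mat N) : Module.End ℂ (Mat N) :=
  mulLeft ℂ A + mulRight ℂ E + mulLeft ℂ A * mulRight ℂ E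

theorem one_add_conjSub_pow (A E Y : Mat N) (x : ℕ) :
    ((1 + conjSub A E) ^ x) Y = (1 + A) ^ x * Y * (1 + E) ^ x := by
  induction x with
  | zero => simp
  | succ x ih =>
    rw [pow_succ', Module.End.mul_apply, ih, pow_succ' (1 + A), pow_succ (1 + E)]
    simp only [conjSub, LinearMap.add_apply, Module.End.mul_apply, Module.End.one_apply,
      mulLeft_apply, mulRight_apply]
    noncomm_ring

theorem commute_mulLeft_mulLeft_mul_mulRight (A E : Mat N) :
    Commute (mulLeft ℂ A) (mulLeft ℂ A * mulRight ℂ E) :=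
  (Commute.refl _).mul_right (commute_mulLeft_right A E)

theorem commute_mulRight_mulLeft_mul_mulRight (A E : Mat N) :
    Commute (mulRight ℂ E) (mulLeft ℂ A * mulRight ℂ E) :=
  (commute_mulLeft_right A E).symm.mul_right (Commute.refl _)

theorem isNilpotent_conjSub {A E : Mat N} (hA : IsNilpotent A) (hE : IsNilpotent E) :
    IsNilpotent (conjSub A E) := by
  have hA' := (isNilpotent_mulLeft_iff ℂ A).2 hA
  have hE' := (isNilpotent_mulRight_iff ℂ E).2 hE
  refine Commute.isNilpotent_add ?_ ((commute_mulLeft_right A E).isNilpotent_add hA' hE') ?_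
  · exact (commute_mulLeft_mulLeft_mul_mulRight A E).add_left
      (commute_mulRight_mulLeft_mul_mulRight A E)
  · exact (commute_mulLeft_right A E).isNilpotent_mul_right hA'

/-- The number of terms does not depend on `x`, so the power is polynomial in `x`. This serves both
the summation of the weight and the rationality of `C_n`. -/
theorem one_add_pow_eq_sum {R : Type*} [Ring R] [Algebra ℂ R] {ν : R} {K : ℕ} (h : ν ^ K = 0)
    (x : ℕ) : (1 + ν) ^ x = ∑ k ∈ Finset.range K, (x.choose k : ℂ) • ν ^ k := by
  rw [add_comm, (Commute.one_right ν).add_pow]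
  have e : ∀ k, ν ^ k * 1 ^ (x - k) * (x.choose k : R) = (x.choose k : ℂ) • ν ^ k := fun k => by
    rw [one_pow, mul_one, Nat.cast_smul_eq_nsmul, nsmul_eq_mul, (Nat.cast_commute _ _).eq]
  simp only [e]
  rcases le_total K (x + 1) with hK | hK
  · symm
    refine Finset.sum_subset (Finset.range_subset_range.2 hK) fun k _ hk => ?_
    rw [pow_eq_zero_of_le (by simpa using hk) h, smul_zero]
  · refine Finset.sum_subset (Finset.range_subset_range.2 hK) fun k _ hk => ?_
    rw [Nat.choose_eq_zero_of_lt (by simp at hk; omega)]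
    simp

theorem conj_pow_eq_sum {A E : Mat N} {K : ℕ} (h : conjSub A E ^ K = 0) (Y : Mat N) (x : ℕ) :
    (1 + A) ^ x * Y * (1 + E) ^ x =
      ∑ k ∈ Finset.range K, (x.choose k : ℂ) • (conjSub A E ^ k) Y := by
  rw [← one_add_conjSub_pow, one_add_pow_eq_sum h]
  simp

theorem exists_hasMoments_conj_pow {a : ℝ} (ha : 0 < a) {A E : Mat N} (hA : IsNilpotent A)
    (hE : IsNilpotent E) (Y : Mat N) :
    ∃ m, HasMoments (fun x : ℕ => ((a ^ x / (x.factorial : ℝ) : ℝ) : ℂ) •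
      ((1 + A) ^ x * Y * (1 + E) ^ x)) m := by
  obtain ⟨K, hK⟩ := isNilpotent_conjSub hA hE
  have key : ∀ m, Summable fun x : ℕ => (x : ℂ) ^ m • (((a ^ x / (x.factorial : ℝ) : ℝ) : ℂ) •
      ((1 + A) ^ x * Y * (1 + E) ^ x)) := fun m => by
    have hs := summable_sum (s := Finset.range K) fun k _ =>
      (Complex.summable_ofReal.2 (summable_pow_mul_choose a ha m k)).smul_const
        ((conjSub A E ^ k) Y)
    refine (hs.congr fun x => ?_)
    rw [conj_pow_eq_sum hK, Finset.smul_sum, Finset.smul_sum]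
    refine Finset.sum_congr rfl fun k _ => ?_
    rw [smul_smul, smul_smul]
    push_cast
    ring_nf
  exact ⟨_, fun m => (key m).hasSum⟩

theorem exp_smul_mulLeft (c : ℂ) {A : Mat N} (hA : IsNilpotent A) :
    IsNilpotent.exp (c • mulLeft ℂ A) = mulLeft ℂ (IsNilpotent.exp (c • A)) := by
  obtain ⟨k, hk⟩ := hA
  rw [exp_smul_eq_sum c (k := k) (by rw [pow_mulLeft, hk, mulLeft_zero_eq_zero]),
    exp_smul_eq_sum c hk]
  ext1 Y
  simp [pow_mulLeft, Finset.sum_mul]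

theorem exp_smul_mulRight (c : ℂ) {E : Mat N} (hE : IsNilpotent E) :
    IsNilpotent.exp (c • mulRight ℂ E) = mulRight ℂ (IsNilpotent.exp (c • E)) := by
  obtain ⟨k, hk⟩ := hE
  rw [exp_smul_eq_sum c (k := k) (by rw [pow_mulRight, hk, mulRight_zero_eq_zero]),
    exp_smul_eq_sum c hk]
  ext1 Y
  simp [pow_mulRight, Finset.mul_sum]

theorem exp_smul_mulLeft_mul_mulRight (c : ℂ) {A E : Mat N} {k : ℕ} (hA : A ^ k = 0)
    (Y : Mat N) :
    IsNilpotent.exp (c • (mulLeft ℂ A * mulRight ℂ E)) Y =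
      ∑ r ∈ Finset.range k, (c ^ r / (r.factorial : ℂ)) • (A ^ r * Y * E ^ r) := by
  rw [exp_smul_eq_sum c (k := k)]
  · simp [(commute_mulLeft_right A E).mul_pow, pow_mulLeft, pow_mulRight, mul_assoc]
  · rw [(commute_mulLeft_right A E).mul_pow, pow_mulLeft, hA, mulLeft_zero_eq_zero, zero_mul]

/-- Left multiplication by `A`, right multiplication by `E` and their product are commuting
nilpotents, so the exponential of their sum factors into three. -/
theorem exp_smul_conjSub (c : ℂ) {A E : Mat N} {k : ℕ} (hA : A ^ k = 0) (hE : IsNilpotent E)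
    (Y : Mat N) :
    IsNilpotent.exp (c • conjSub A E) Y = IsNilpotent.exp (c • A) *
      (∑ r ∈ Finset.range k, (c ^ r / (r.factorial : ℂ)) • (A ^ r * Y * E ^ r)) *
        IsNilpotent.exp (c • E) := by
  have hA' : IsNilpotent (c • mulLeft ℂ A) := ((isNilpotent_mulLeft_iff ℂ A).2 ⟨k, hA⟩).smul c
  have hE' : IsNilpotent (c • mulRight ℂ E) := ((isNilpotent_mulRight_iff ℂ E).2 hE).smul c
  have hAE : IsNilpotent (c • (mulLeft ℂ A * mulRight ℂ E)) :=
    ((commute_mulLeft_right A E).isNilpotent_mul_right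
      ((isNilpotent_mulLeft_iff ℂ A).2 ⟨k, hA⟩)).smul c
  have h1 : Commute (c • mulLeft ℂ A) (c • mulRight ℂ E) :=
    ((commute_mulLeft_right A E).smul_left c).smul_right c
  have h2 : Commute (c • mulLeft ℂ A + c • mulRight ℂ E) (c • (mulLeft ℂ A * mulRight ℂ E)) :=
    (((commute_mulLeft_mulLeft_mul_mulRight A E).smul_left c).smul_right c).add_left
      (((commute_mulRight_mulLeft_mul_mulRight A E).smul_left c).smul_right c)
  rw [conjSub, smul_add, smul_add, IsNilpotent.exp_add_of_commute h2
    (h1.isNilpotent_add hA' hE') hAE, IsNilpotent.exp_add_of_commute h1 hA' hE',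
    exp_smul_mulLeft c ⟨k, hA⟩, exp_smul_mulRight c hE, Module.End.mul_apply, Module.End.mul_apply,
    exp_smul_mulLeft_mul_mulRight c hA, mulLeft_apply, mulRight_apply, mul_assoc]

/-- `∑ a ^ x / x! (1 + A) ^ x Y (1 + E) ^ x` for nilpotent `A` and `E`. -/
theorem hasSum_conj_pow (a : ℝ) {A E : Mat N} {k : ℕ} (hA : A ^ k = 0) (hE : IsNilpotent E)
    (Y : Mat N) :
    HasSum (fun x : ℕ => ((a ^ x / (x.factorial : ℝ) : ℝ) : ℂ) •
      ((1 + A) ^ x * Y * (1 + E) ^ x))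
      (((Real.exp a : ℝ) : ℂ) • (IsNilpotent.exp ((a : ℂ) • A) *
        (∑ r ∈ Finset.range k, ((a : ℂ) ^ r / (r.factorial : ℂ)) • (A ^ r * Y * E ^ r)) *
          IsNilpotent.exp ((a : ℂ) • E))) := by
  obtain ⟨K, hK⟩ := isNilpotent_conjSub ⟨k, hA⟩ hE
  rw [← exp_smul_conjSub _ hA hE, exp_smul_eq_sum _ hK]
  -- The Poisson average of `x.choose k` is `a ^ k / k!`, up to `e ^ a`: binomial expansion becomes
  -- the exponential series.
  have hs := hasSum_sum (s := Finset.range K) fun k _ =>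
    (Complex.hasSum_ofReal.2 (hasSum_choose_mul_pow_div_factorial a k)).smul_const
      ((conjSub A E ^ k) Y)
  have e : ((Real.exp a : ℝ) : ℂ) • (∑ i ∈ Finset.range K,
      ((a : ℂ) ^ i / (i.factorial : ℂ)) • conjSub A E ^ i) Y = ∑ k ∈ Finset.range K,
      ((Real.exp a * (a ^ k / (k.factorial : ℝ)) : ℝ) : ℂ) • (conjSub A E ^ k) Y := by
    rw [LinearMap.sum_apply, Finset.smul_sum]
    refine Finset.sum_congr rfl fun k _ => ?_
    rw [LinearMap.smul_apply, smul_smul]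
    push_cast
    rfl
  rw [e]
  refine hasSum_of_eq hs fun x => ?_
  rw [conj_pow_eq_sum hK, Finset.smul_sum]
  refine Finset.sum_congr rfl fun k _ => ?_
  rw [smul_smul]
  push_cast
  rfl

end Conjugation

/-! ### Commutation relations and the Pearson equations -/

section Relations

variable {R : Type*} [Ring R] [Algebra ℂ R]

theorem natCast_eq_smul_one (x : ℕ) : (x : R) = (x : ℂ) • (1 : R) := by
  rw [← Algebra.algebraMap_eq_smul_one, map_natCast]

theorem natCast_mul_eq_smul (x : ℕ) (r : R) : (x : R) * r = (x : ℂ) • r := by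
  rw [natCast_eq_smul_one, smul_mul_assoc, one_mul]

theorem mul_natCast_eq_smul (x : ℕ) (r : R) : r * (x : R) = (x : ℂ) • r := by
  rw [natCast_eq_smul_one, mul_smul_comm, mul_one]

/-- The relations `[J, A] = A`, `[A, F] = H`, `[A, H] = -(2 / a) A` together with an inverse `U`
of `1 + A`. -/
structure LadderRelations (a : ℂ) (A J F H U : R) : Prop where
  ne_zero : a ≠ 0
  J_mul_A : J * A = A * J + A
  A_mul_F : A * F = F * A + H
  A_mul_H : A * H = H * A - (2 / a) • A
  one_add_mul : (1 + A) * U = 1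
  mul_one_add : U * (1 + A) = 1

namespace LadderRelations

variable {a : ℂ} {A J F H U : R}

theorem commute (h : LadderRelations a A J F H U) : A * U = U * A := by
  have h1 := h.one_add_mul
  have h2 := h.mul_one_add
  rw [add_mul, one_mul] at h1
  rw [mul_add, mul_one] at h2
  exact add_left_cancel (h1.trans h2.symm)

theorem A_mul_J (h : LadderRelations a A J F H U) : A * J = (J - 1) * A := by
  rw [sub_mul, h.J_mul_A]; simp

/-- Each factor `1 + A` contributes `-A U`, which commutes with `1 + A`; hence the linear growth in
`y`. -/
theorem pow_mul_J (h : LadderRelations a A J F H U) (y : ℕ) :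
    (1 + A) ^ y * J = (J - (y : ℂ) • (A * U)) * (1 + A) ^ y := by
  induction y with
  | zero => simp
  | succ y ih =>
    have h1 : (1 + A) * J = (J - A * U) * (1 + A) := by
      rw [sub_mul, mul_assoc, h.mul_one_add, add_mul, h.A_mul_J]
      noncomm_ring
    have h2 : (1 + A) * (A * U) = A * U * (1 + A) := by
      rw [mul_assoc A U, h.mul_one_add, h.commute, ← mul_assoc, h.one_add_mul, one_mul, mul_one]
    rw [pow_succ' (1 + A), mul_assoc, ih, ← mul_assoc, mul_sub, h1, mul_smul_comm, h2,
      ← smul_mul_assoc, ← sub_mul, mul_assoc]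
    congr 1
    push_cast
    module

theorem one_add_mul_H_mul (h : LadderRelations a A J F H U) :
    (1 + A) * (H * U) = H - (2 / a) • (A * U) := by
  have h1 : (1 + A) * H = H * (1 + A) - (2 / a) • A := by
    rw [add_mul, h.A_mul_H]
    noncomm_ring
  rw [← mul_assoc, h1, sub_mul, mul_assoc, h.one_add_mul, mul_one, smul_mul_assoc]

/-- Each factor contributes `H U`, which itself changes by the fixed amount `-(2 / a) A U U` at
every step; summing the progression gives `y (y - 1) / a`. -/
theorem pow_mul_F (h : LadderRelations a A J F H U) (y : ℕ) :
    (1 + A) ^ y * F = (F + (y : ℂ) • (H * U) - ((y : ℂ) * (y - 1) / a) • (A * U * U)) *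
      (1 + A) ^ y := by
  induction y with
  | zero => simp
  | succ y ih =>
    have h1 : (1 + A) * F = (F + H * U) * (1 + A) := by
      rw [add_mul, one_mul, h.A_mul_F, add_mul F, mul_assoc H, h.mul_one_add]
      noncomm_ring
    have h2 : (1 + A) * (H * U) = (H * U - (2 / a) • (A * U * U)) * (1 + A) := by
      rw [h.one_add_mul_H_mul, sub_mul, smul_mul_assoc, mul_assoc H, mul_assoc (A * U),
        h.mul_one_add, mul_one, mul_one]
    have h3 : (1 + A) * (A * U * U) = A * U * U * (1 + A) := by
      rw [mul_assoc (A * U), h.mul_one_add, mul_one, h.commute, mul_assoc U, h.commute, ← mul_assoc,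
        h.one_add_mul, one_mul]
    have h4 : F + ((y + 1 : ℕ) : ℂ) • (H * U) -
        (((y + 1 : ℕ) : ℂ) * ((y + 1 : ℕ) - 1) / a) • (A * U * U) =
        (F + H * U) + (y : ℂ) • (H * U - (2 / a) • (A * U * U)) -
          ((y : ℂ) * (y - 1) / a) • (A * U * U) := by
      have := h.ne_zero
      push_cast
      match_scalars <;> field_simp <;> ring
    rw [pow_succ' (1 + A), mul_assoc, ih, ← mul_assoc, ← mul_assoc, h4]
    congr 1
    rw [sub_mul, add_mul _ _ (1 + A), smul_mul_assoc, smul_mul_assoc, mul_sub, mul_add,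
      mul_smul_comm, mul_smul_comm, h1, h2, h3]

/-- The coefficient of `X ^ 2` in `Φ` and `Ψ`. -/
def quadratic (A U : R) : R := (-1 / 2 : ℂ) • (A * U)

/-- The coefficient of `X` in `Φ`. -/
def linear (a : ℂ) (A H U : R) (lam : ℕ) : R :=
  (-a / 2) • A + (a / 2) • H - (lam + 1 / 2 : ℂ) • (A * U)

/-- The constant coefficient of `Φ`. -/
def constant (a : ℂ) (A J F H U : R) (lam : ℕ) : R :=
  (a / 2) • ((1 + A) * ((lam : ℂ) • 1 + J - (lam : ℂ) • (A * U) +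
    (F + (lam : ℂ) • (H * U) - ((lam : ℂ) * (lam - 1) / a) • (A * U * U))))

/-- The coefficient of `X` in `Ψ`. -/
def linear' (A J U : R) (lam : ℕ) : R :=
  (1 / 2 : ℂ) • ((lam : ℂ) • 1 + J) - (lam / 2 : ℂ) • (A * U)

theorem constant_mul_pow (h : LadderRelations a A J F H U) (lam : ℕ) :
    constant a A J F H U lam * (1 + A) ^ lam =
      (a / 2) • ((1 + A) ^ (lam + 1) * ((lam : ℂ) • 1 + J + F)) := by
  rw [pow_succ', mul_assoc, mul_add ((1 + A) ^ lam), mul_add ((1 + A) ^ lam), h.pow_mul_J,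
    h.pow_mul_F, mul_smul_comm, mul_one, constant, smul_mul_assoc, mul_assoc]
  congr 2
  simp only [add_mul _ _ ((1 + A) ^ lam), sub_mul _ _ ((1 + A) ^ lam), smul_mul_assoc, one_mul]
  abel

/-- The outer factor `1 + A` cancels one `U` in each term, which leaves an expression quadratic in
`x` whose leading coefficient is `quadratic A U`. -/
theorem Phi_eq (h : LadderRelations a A J F H U) (lam x : ℕ) :
    quadratic A U * (x : R) ^ 2 + linear a A H U lam * x + constant a A J F H U lam =
      (a / 2) • ((1 + A) * ((lam : ℂ) • 1 + (J - ((x + lam : ℕ) : ℂ) • (A * U)) +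
        (F + ((x + lam : ℕ) : ℂ) • (H * U) -
          (((x + lam : ℕ) : ℂ) * ((x + lam : ℕ) - 1) / a) • (A * U * U)))) := by
  have h1 : (1 + A) * (A * U) = A := by
    rw [h.commute, ← mul_assoc, h.one_add_mul, one_mul]
  have h3 : (1 + A) * (A * U * U) = A * U := by
    rw [h.commute, mul_assoc, h.commute, ← mul_assoc, h.one_add_mul, one_mul]
  have := h.ne_zero
  rw [natCast_eq_smul_one x, quadratic, linear, constant, _root_.smul_pow, one_pow]
  simp only [mul_add, mul_sub (1 + A), mul_smul_comm, h1, h.one_add_mul_H_mul, h3, mul_one]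
  push_cast
  match_scalars <;> field_simp <;> ring

/-- The extra right factor is absorbed by `T₁ (1 + E) = (a / 2)(lam + J + F) T`; then `J` and `F`
are moved to the left of `(1 + A) ^ (x + lam)`. -/
theorem Phi_mul (h : LadderRelations a A J F H U) {E T T₁ : R} {lam : ℕ}
    (hT : T₁ = (a / 2) • (((lam : ℂ) • 1 + J) * T)) (hE : T₁ * E = (a / 2) • (F * T)) (x : ℕ) :
    (quadratic A U * (x : R) ^ 2 + linear a A H U lam * x + constant a A J F H U lam) *
      ((1 + A) ^ (x + lam) * T * (1 + E) ^ (x + lam)) =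
      (1 + A) ^ (x + (lam + 1)) * T₁ * (1 + E) ^ (x + (lam + 1)) := by
  have h1 : (1 + A) ^ (x + (lam + 1)) * T₁ * (1 + E) ^ (x + (lam + 1)) =
      (1 + A) * ((1 + A) ^ (x + lam) * (T₁ + T₁ * E)) * (1 + E) ^ (x + lam) := by
    rw [← add_assoc, pow_succ', pow_succ' (1 + E)]
    noncomm_ring
  rw [h1, hE, hT, ← smul_add, ← add_mul, mul_smul_comm, ← mul_assoc ((1 + A) ^ (x + lam)),
    mul_add ((1 + A) ^ (x + lam)), mul_add ((1 + A) ^ (x + lam)), h.pow_mul_J, h.pow_mul_F,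
    h.Phi_eq]
  simp only [mul_add, add_mul, smul_mul_assoc, mul_smul_comm, mul_assoc, one_mul]

/-- The scalar `x / a` turns `a ^ x / x!` into `a ^ (x - 1) / (x - 1)!`, which produces the shift of
the weight in the second Pearson equation. -/
theorem Psi_mul (h : LadderRelations a A J F H U) {E T T₁ : R} {lam : ℕ}
    (hT : T₁ = (a / 2) • (((lam : ℂ) • 1 + J) * T)) (x : ℕ) :
    (quadratic A U * (x : R) ^ 2 + linear' A J U lam * x) *
      ((1 + A) ^ (x + lam) * T * (1 + E) ^ (x + lam)) =
      (x / a : ℂ) • ((1 + A) ^ (x + lam) * T₁ * (1 + E) ^ (x + lam)) := by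
  have h1 : quadratic A U * (x : R) ^ 2 + linear' A J U lam * x =
      (x / 2 : ℂ) • ((lam : ℂ) • 1 + (J - ((x + lam : ℕ) : ℂ) • (A * U))) := by
    rw [natCast_eq_smul_one x, quadratic, linear', _root_.smul_pow, one_pow]
    simp only [mul_smul_comm, mul_one]
    push_cast
    module
  have := h.ne_zero
  rw [h1, hT, mul_smul_comm, smul_mul_assoc (a / 2), smul_smul, ← mul_assoc ((1 + A) ^ (x + lam)),
    mul_add ((1 + A) ^ (x + lam)), h.pow_mul_J, mul_smul_comm, mul_one]
  rw [show (x : ℂ) / a * (a / 2) = x / 2 by field_simp]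
  simp only [add_mul, smul_mul_assoc, mul_assoc, one_mul]

/-- The leading coefficient produced by the raising operator in degree `n + 1`. -/
def leading (a : ℂ) (A J U : R) (N lam n : ℕ) : R :=
  (-1 / 2 : ℂ) • ((lam + N + 1 : ℂ) • 1 - J + a • A + (n + 1 + lam : ℂ) • (A * U))

theorem leading_eq {N : ℕ} (ha : a ≠ 0) (hH : H = (1 / a) • ((2 : ℂ) • J - (N + 1 : ℂ) • 1))
    (lam n : ℕ) :
    n * quadratic A U + linear a A H U lam - linear' A J U lam = leading a A J U N lam n := by
  rw [natCast_eq_smul_one n, quadratic, linear, linear', leading, hH]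
  simp only [smul_mul_assoc, one_mul]
  match_scalars <;> field_simp <;> ring

theorem pow_mul_J' (h : LadderRelations a A J F H U) (k : ℕ) :
    A ^ k * J = (J - (k : ℂ) • 1) * A ^ k := by
  induction k with
  | zero => simp
  | succ k ih =>
    rw [pow_succ', mul_assoc, ih, ← mul_assoc, ← mul_assoc, mul_sub, h.A_mul_J, mul_smul_comm,
      mul_one]
    congr 1
    rw [sub_mul, sub_mul, smul_mul_assoc, one_mul]
    push_cast
    module

theorem pow_mul_F' (h : LadderRelations a A J F H U) (k : ℕ) :
    A ^ (k + 1) * F = F * A ^ (k + 1) + (k + 1 : ℂ) • (H * A ^ k) -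
      ((k + 1 : ℂ) * k / a) • A ^ k := by
  have hH : ∀ k : ℕ, A * (H * A ^ k) = H * A ^ (k + 1) - (2 / a) • A ^ (k + 1) := fun k => by
    rw [← mul_assoc, h.A_mul_H, sub_mul, smul_mul_assoc, mul_assoc, ← pow_succ']
  have hF : ∀ k : ℕ, A * (F * A ^ k) = F * A ^ (k + 1) + H * A ^ k := fun k => by
    rw [← mul_assoc, h.A_mul_F, add_mul, mul_assoc, ← pow_succ']
  have := h.ne_zero
  induction k with
  | zero => simp [h.A_mul_F]
  | succ k ih =>
    rw [pow_succ', mul_assoc, ih, mul_sub, mul_add, mul_smul_comm, mul_smul_comm, hH, hF,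
      ← pow_succ', ← pow_succ']
    push_cast
    match_scalars <;> field_simp <;> ring

/-- The commutator `[aA, J] = -aA` commutes with `A`, so conjugation by the exponential stops at
first order. -/
theorem exp_mul_J (h : LadderRelations a A J F H U) [Module ℚ R] (hA : IsNilpotent A) :
    IsNilpotent.exp (a • A) * J = (J - a • A) * IsNilpotent.exp (a • A) := by
  obtain ⟨k, hk⟩ := hA
  have e1 := exp_smul_eq_sum a hk
  have e2 := exp_smul_eq_sum a (show A ^ (k + 1) = 0 by rw [pow_succ, hk, zero_mul])
  have h1 : a • A * IsNilpotent.exp (a • A) = ∑ i ∈ Finset.range (k + 1),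
      (i * (a ^ i / (i.factorial : ℂ))) • A ^ i := by
    rw [Finset.sum_range_succ', e1, Finset.mul_sum]
    simp only [Nat.cast_zero, zero_mul, zero_smul, add_zero]
    refine Finset.sum_congr rfl fun i _ => ?_
    rw [smul_mul_smul_comm, ← pow_succ', Nat.factorial_succ]
    congr 1
    push_cast
    field_simp
    ring
  rw [sub_mul, h1, e2, Finset.sum_mul, Finset.mul_sum, ← Finset.sum_sub_distrib]
  refine Finset.sum_congr rfl fun i _ => ?_
  rw [smul_mul_assoc, h.pow_mul_J', sub_mul, smul_mul_assoc, one_mul, mul_smul_comm, smul_sub,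
    smul_smul, mul_comm]

/-- The second commutator contributes `(a² / 2)[A, H] = -aA`, and all higher ones vanish. -/
theorem exp_mul_F (h : LadderRelations a A J F H U) [Module ℚ R] (hA : IsNilpotent A) :
    IsNilpotent.exp (a • A) * F = (F + a • H - a • A) * IsNilpotent.exp (a • A) := by
  obtain ⟨k, hk⟩ := hA
  -- The same exponential is truncated at three lengths, so that the index shifts from `H A ^ i` and
  -- `A ^ (i + 1)` line up term by term.
  have e1 := exp_smul_eq_sum a hk
  have e2 := exp_smul_eq_sum a (show A ^ (k + 1) = 0 by rw [pow_succ, hk, zero_mul])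
  have e3 := exp_smul_eq_sum a (show A ^ (k + 1 + 1) = 0 by
    rw [pow_succ, pow_succ, hk, zero_mul, zero_mul])
  have ha := h.ne_zero
  have h1 : a • H * IsNilpotent.exp (a • A) = ∑ i ∈ Finset.range (k + 1),
      ((i + 1 : ℂ) * (a ^ (i + 1) / ((i + 1).factorial : ℂ))) • (H * A ^ i) := by
    rw [e2, Finset.mul_sum]
    refine Finset.sum_congr rfl fun i _ => ?_
    rw [smul_mul_smul_comm, Nat.factorial_succ]
    congr 1
    push_cast
    field_simp
    ring
  have h2 : a • A * IsNilpotent.exp (a • A) = ∑ i ∈ Finset.range (k + 1),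
      ((i + 1 : ℂ) * i / a * (a ^ (i + 1) / ((i + 1).factorial : ℂ))) • A ^ i := by
    rw [Finset.sum_range_succ', e1, Finset.mul_sum]
    simp only [Nat.cast_zero, mul_zero, zero_div, zero_mul, zero_smul, add_zero]
    refine Finset.sum_congr rfl fun i _ => ?_
    rw [smul_mul_smul_comm, ← pow_succ', Nat.factorial_succ, Nat.factorial_succ]
    congr 1
    push_cast
    field_simp
    ring
  rw [sub_mul, add_mul, h1, h2, e3, Finset.sum_mul, Finset.sum_range_succ', Finset.mul_sum,
    Finset.sum_range_succ' _ (k + 1), add_right_comm, add_sub_right_comm, ← Finset.sum_add_distrib,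
    ← Finset.sum_sub_distrib]
  congr 1
  · refine Finset.sum_congr rfl fun i _ => ?_
    rw [smul_mul_assoc, h.pow_mul_F', mul_smul_comm]
    module
  · simp

/-- The conjugating factor `g = e ^ {aA} (1 + A) ^ y` diagonalizes `leading`. -/
theorem leading_mul (h : LadderRelations a A J F H U) [Module ℚ R] (hA : IsNilpotent A)
    (N lam n : ℕ) :
    leading a A J U N lam n * (IsNilpotent.exp (a • A) * (1 + A) ^ (n + 1 + lam)) =
      (-1 / 2 : ℂ) • (IsNilpotent.exp (a • A) * (1 + A) ^ (n + 1 + lam) *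
        ((lam + N + 1 : ℂ) • 1 - J)) := by
  have hAU : Commute (A * U) (IsNilpotent.exp (a • A)) := by
    obtain ⟨k, hk⟩ := hA
    rw [exp_smul_eq_sum a hk]
    refine Commute.sum_right _ _ _ fun i _ => Commute.smul_right (Commute.pow_right ?_ i) _
    exact (Commute.refl A).mul_left (show U * A = A * U from h.commute.symm)
  have hJ : IsNilpotent.exp (a • A) * (1 + A) ^ (n + 1 + lam) * J =
      (J - a • A - ((n + 1 + lam : ℕ) : ℂ) • (A * U)) *
        (IsNilpotent.exp (a • A) * (1 + A) ^ (n + 1 + lam)) := by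
    rw [mul_assoc, h.pow_mul_J, ← mul_assoc, ← mul_assoc, mul_sub, h.exp_mul_J hA, mul_smul_comm,
      ← hAU.eq, ← smul_mul_assoc, ← sub_mul]
  rw [mul_sub, mul_smul_comm, mul_one, hJ, leading]
  generalize IsNilpotent.exp (a • A) * (1 + A) ^ (n + 1 + lam) = g
  simp only [add_mul, sub_mul, smul_mul_assoc, one_mul]
  push_cast
  module

/-- The relation that determines the constant coefficient of the polynomial of degree one. -/
theorem exp_mul_add (h : LadderRelations a A J F H U) [Module ℚ R] (hA : IsNilpotent A) {N : ℕ}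
    (hH : H = (1 / a) • ((2 : ℂ) • J - (N + 1 : ℂ) • 1)) (lam : ℕ) :
    IsNilpotent.exp (a • A) * (F + ((lam + N + 1 : ℂ) • 1 - J)) =
      ((lam : ℂ) • 1 + J + F) * IsNilpotent.exp (a • A) := by
  have ha := h.ne_zero
  rw [mul_add, mul_sub, mul_smul_comm, mul_one, h.exp_mul_F hA, h.exp_mul_J hA]
  have e : (lam : ℂ) • 1 + J + F = (F + a • H - a • A) + ((lam + N + 1 : ℂ) • 1 - (J - a • A)) := by
    rw [hH]
    match_scalars <;> field_simp <;> ring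
  rw [e, add_mul (F + a • H - a • A), sub_mul ((lam + N + 1 : ℂ) • 1), smul_mul_assoc, one_mul]

end LadderRelations

end Relations

/-! ### The concrete matrices: entries, relations and `L₀` -/

section Entries

variable {N : ℕ} {a : ℝ} {μ : Fin N → ℝ}

theorem matA_pow (hμ : ∀ j, 0 < μ j) (r : ℕ) :
    matA μ ^ r =
      Matrix.of fun i k : Fin N => if (i : ℕ) = k + r then ((μ i / μ k : ℝ) : ℂ) else 0 := by
  induction r with
  | zero =>
    ext i k
    rw [pow_zero, Matrix.one_apply, Matrix.of_apply, add_zero]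
    by_cases h : i = k
    · subst h
      simp [(hμ i).ne']
    · rw [if_neg h, if_neg (fun e => h (Fin.ext e))]
  | succ r ih =>
    ext i k
    rw [pow_succ', ih, Matrix.mul_apply]
    simp only [matA, Matrix.of_apply]
    by_cases h : (i : ℕ) = k + (r + 1)
    · have hj : (k : ℕ) + r < N := by omega
      rw [if_pos h, Finset.sum_eq_single ⟨k + r, hj⟩]
      · rw [if_pos (by simp only [h]; omega), if_pos rfl, ← Complex.ofReal_mul,
          div_mul_div_cancel₀ (hμ _).ne']
      · intro b _ hb
        rw [if_neg (fun e => hb (Fin.ext e)) (c := (b : ℕ) = k + r), mul_zero]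
      · simp
    · rw [if_neg h]
      refine Finset.sum_eq_zero fun b _ => ?_
      by_cases h1 : (b : ℕ) = k + r
      · rw [if_neg (by omega), zero_mul]
      · rw [if_neg h1, mul_zero]

theorem matA_pow_card (hμ : ∀ j, 0 < μ j) : matA μ ^ N = 0 := by
  rw [matA_pow hμ]
  ext i k
  rw [Matrix.of_apply, if_neg (by omega), Matrix.zero_apply]

theorem isNilpotent_matA (hμ : ∀ j, 0 < μ j) : IsNilpotent (matA μ) := ⟨N, matA_pow_card hμ⟩

theorem isNilpotent_conjTranspose {A : Mat N} (hA : IsNilpotent A) :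
    IsNilpotent A.conjTranspose := by
  obtain ⟨k, hk⟩ := hA
  exact ⟨k, by rw [← Matrix.conjTranspose_pow, hk, Matrix.conjTranspose_zero]⟩

theorem MuCondition.sq_mul (ha : 0 < a) (h : MuCondition a μ) {i k : Fin N} {r : ℕ}
    (hr : (i : ℕ) = k + r) :
    (μ i / μ k) ^ 2 * a ^ r * ((N - (i + 1) : ℕ).factorial : ℝ) =
      ((N - (k + 1) : ℕ).factorial : ℝ) := by
  rw [h i k, show ((k : ℕ) : ℤ) - ((i : ℕ) : ℤ) = -(r : ℤ) by omega, zpow_neg, zpow_natCast]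
  have := (N - (i + 1) : ℕ).factorial_ne_zero
  have := ha.ne'
  field_simp

theorem matA_pow_mul_diagonal (hμ : ∀ j, 0 < μ j) (r : ℕ) (d : ℕ → ℂ) :
    matA μ ^ r * Matrix.diagonal (fun i : Fin N => d i) * (matA μ).conjTranspose ^ r =
      Matrix.diagonal fun i : Fin N => if h : r ≤ i then
        (((μ i / μ ⟨i - r, by omega⟩) ^ 2 : ℝ) : ℂ) * d (i - r) else 0 := by
  rw [← Matrix.conjTranspose_pow, matA_pow hμ]
  ext i k
  rw [Matrix.mul_apply]
  simp only [Matrix.mul_diagonal, Matrix.of_apply, Matrix.conjTranspose_apply]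
  by_cases h : r ≤ i
  · rw [Finset.sum_eq_single ⟨i - r, by omega⟩]
    · rw [if_pos (by simp only; omega)]
      by_cases hik : i = k
      · subst hik
        rw [if_pos (by simp only; omega), Matrix.diagonal_apply_eq, dif_pos h, Complex.star_def,
          Complex.conj_ofReal]
        push_cast
        ring
      · rw [Matrix.diagonal_apply_ne _ hik, if_neg (by
          simp only; intro e; exact hik (Fin.ext (by omega))), star_zero, mul_zero]
    · intro b _ hb
      rw [if_neg (fun e => hb (Fin.ext (by simp only; omega))), zero_mul, zero_mul]
    · simp
  · rw [Finset.sum_eq_zero fun b _ => by rw [if_neg (by omega), zero_mul, zero_mul]]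
    by_cases hik : i = k
    · subst hik
      rw [Matrix.diagonal_apply_eq, dif_neg h]
    · rw [Matrix.diagonal_apply_ne _ hik]

/-- The condition on `μ` gives `(μ_{j+1} / μ_j)² = (N - j) / a`; the formula also covers `j = N`,
where the sum is empty. -/
theorem conjTranspose_mul_matA (ha : 0 < a) (hμ' : MuCondition a μ) :
    (matA μ).conjTranspose * matA μ =
      Matrix.diagonal fun i : Fin N => (((N : ℝ) - i - 1) / a : ℂ) := by
  ext i k
  rw [Matrix.mul_apply]
  simp only [Matrix.of_apply, Matrix.conjTranspose_apply, matA]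
  by_cases h : (i : ℕ) + 1 < N
  · rw [Finset.sum_eq_single ⟨i + 1, h⟩]
    · rw [if_pos rfl]
      by_cases hik : i = k
      · subst hik
        have := hμ'.sq_mul ha (i := ⟨i + 1, h⟩) (k := i) (r := 1) rfl
        have e : N - (i + 1) = N - (i + 1 + 1) + 1 := by omega
        have e2 : ((N - (i + 1 + 1) : ℕ) : ℝ) = (N : ℝ) - i - 1 - 1 := by
          rw [Nat.cast_sub (by omega)]; push_cast; ring
        rw [e, Nat.factorial_succ, Nat.cast_mul, Nat.cast_add_one, e2, pow_one] at this
        have h1 := mul_right_cancel₀ (Nat.cast_ne_zero.2 (Nat.factorial_ne_zero _)) this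
        have h2 : (μ ⟨i + 1, h⟩ / μ i) ^ 2 = ((N : ℝ) - i - 1) / a := by
          rw [eq_div_iff ha.ne', h1]; ring
        rw [if_pos rfl, Matrix.diagonal_apply_eq, Complex.star_def, Complex.conj_ofReal, ← pow_two,
          ← Complex.ofReal_pow, h2]
        push_cast
        ring
      · rw [Matrix.diagonal_apply_ne _ hik, if_neg (by
          simp only; intro e; exact hik (Fin.ext (by omega))), mul_zero]
    · intro b _ hb
      rw [if_neg (fun e => hb (Fin.ext (by simp only; omega))), star_zero, zero_mul]
    · simp
  · rw [Finset.sum_eq_zero fun b _ => by rw [if_neg (by omega), star_zero, zero_mul]]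
    by_cases hik : i = k
    · subst hik
      have : (N : ℂ) = i + 1 := by
        have : N = i + 1 := by omega
        exact_mod_cast this
      rw [Matrix.diagonal_apply_eq]
      simp [this]
    · rw [Matrix.diagonal_apply_ne _ hik]

theorem matJ_mul_matA : matJ N * matA μ = matA μ * matJ N + matA μ := by
  ext i k
  rw [matJ, Matrix.diagonal_mul, Matrix.add_apply, Matrix.mul_diagonal, matA, Matrix.of_apply]
  split_ifs with h
  · rw [h]; push_cast; ring
  · simp

/-- `[A, J A^*] = H`. -/
def matH (N : ℕ) (a : ℝ) : Mat N := (1 / a : ℂ) • ((2 : ℂ) • matJ N - (N + 1 : ℂ) • 1)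

/-- Both products are diagonal with entries quadratic in the index; the quadratic parts cancel and
leave `H` affine in `J`. -/
theorem matA_mul_matF (ha : 0 < a) (hμ : ∀ j, 0 < μ j) (hμ' : MuCondition a μ) :
    matA μ * (matJ N * (matA μ).conjTranspose) =
      matJ N * (matA μ).conjTranspose * matA μ + matH N a := by
  have h1 := matA_pow_mul_diagonal hμ 1 (fun i => ((i + 1 : ℕ) : ℂ))
  rw [pow_one, pow_one] at h1
  have ha' : (a : ℂ) ≠ 0 := Complex.ofReal_ne_zero.2 ha.ne'
  rw [← mul_assoc, mul_assoc (matJ N), conjTranspose_mul_matA ha hμ', matJ, h1,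
    Matrix.diagonal_mul_diagonal, matH, matJ, ← Matrix.diagonal_one, ← Matrix.diagonal_smul,
    ← Matrix.diagonal_smul, Matrix.diagonal_sub, ← Matrix.diagonal_smul, Matrix.diagonal_add]
  congr 1
  ext i
  simp only [Pi.smul_apply, smul_eq_mul]
  split_ifs with h
  · have := hμ'.sq_mul ha (i := i) (k := ⟨i - 1, by omega⟩) (r := 1) (by simp only; omega)
    have e : N - (i - 1 + 1) = N - (i + 1) + 1 := by omega
    have e2 : ((N - (i + 1) : ℕ) : ℝ) = (N : ℝ) - i - 1 := by
      rw [Nat.cast_sub (by omega)]; push_cast; ring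
    simp only at this
    rw [e, Nat.factorial_succ, Nat.cast_mul, Nat.cast_add_one, e2, pow_one] at this
    have h1 := mul_right_cancel₀ (Nat.cast_ne_zero.2 (Nat.factorial_ne_zero _)) this
    rw [eq_div_of_mul_eq ha.ne' h1, show (i : ℕ) - 1 + 1 = i by omega]
    push_cast
    field_simp
    ring
  · have : (i : ℕ) = 0 := by omega
    rw [this]
    push_cast
    field_simp
    ring

theorem ladderRelations (ha : 0 < a) (hμ : ∀ j, 0 < μ j) (hμ' : MuCondition a μ) :
    LadderRelations (a : ℂ) (matA μ) (matJ N) (matJ N * (matA μ).conjTranspose) (matH N a)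
      (1 + matA μ)⁻¹ := by
  have hu : IsUnit (1 + matA μ).det :=
    (Matrix.isUnit_iff_isUnit_det _).1 (isNilpotent_matA hμ).isUnit_one_add
  refine ⟨Complex.ofReal_ne_zero.2 ha.ne', matJ_mul_matA, matA_mul_matF ha hμ hμ', ?_,
    Matrix.mul_nonsing_inv _ hu, Matrix.nonsing_inv_mul _ hu⟩
  rw [matH, mul_smul_comm, smul_mul_assoc, sub_mul, smul_mul_assoc, matJ_mul_matA, mul_sub,
    mul_smul_comm, mul_smul_comm, smul_mul_assoc, one_mul, mul_one]
  module

theorem delta_succ_lam (lam i : ℕ) :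
    delta a (lam + 1) i = a / 2 * ((lam + (i + 1 : ℕ)) * delta a lam i) := by
  rw [delta, delta, show lam + 1 + i = lam + i + 1 by ring, Nat.factorial_succ, pow_succ]
  push_cast
  ring

/-- Reading `(lam + 1 + i)!` as `(lam + (i + 1))!` moves the increment from `lam` to the index, as
the superdiagonal matrix `A^*` requires. -/
theorem delta_succ_lam' (lam i : ℕ) :
    delta a (lam + 1) i = a / 2 * ((i + 1 : ℕ) * delta a lam (i + 1)) := by
  rw [delta, delta, show lam + 1 + i = lam + (i + 1) by ring, Nat.factorial_succ i, pow_succ]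
  have := i.factorial_ne_zero
  push_cast
  field_simp

theorem matT_succ (lam : ℕ) :
    matT N a (lam + 1) = (a / 2 : ℂ) • (((lam : ℂ) • 1 + matJ N) * matT N a lam) := by
  rw [matT, matT, matJ, ← Matrix.diagonal_one, ← Matrix.diagonal_smul, Matrix.diagonal_add,
    Matrix.diagonal_mul_diagonal, ← Matrix.diagonal_smul]
  congr 1
  ext i
  rw [delta_succ_lam]
  simp

theorem matT_succ_mul (lam : ℕ) :
    matT N a (lam + 1) * (matA μ).conjTranspose =
      (a / 2 : ℂ) • (matJ N * (matA μ).conjTranspose * matT N a lam) := by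
  ext i k
  rw [matT, matT, matJ, Matrix.diagonal_mul, Matrix.smul_apply, Matrix.mul_diagonal,
    Matrix.diagonal_mul, Matrix.conjTranspose_apply, matA, Matrix.of_apply]
  split_ifs with h
  · rw [delta_succ_lam', h]
    push_cast
    rw [smul_eq_mul]
    ring
  · simp

theorem charlier_zero (n : ℕ) : charlier a n 0 = 1 := by
  rw [charlier, Finset.sum_eq_single 0]
  · simp
  · intro k _ hk
    rw [neg_zero, ascPochhammer_eval_zero, if_neg hk]
    simp
  · simp

/-- Since `c_n(0) = 1`, the entries of `L(0)` are those of the exponential series, the ratios of `μ`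
telescoping in the powers of `A`. -/
theorem matL0_eq_exp (hμ : ∀ j, 0 < μ j) :
    matL0 a μ = IsNilpotent.exp ((-a : ℂ) • matA μ) := by
  rw [exp_smul_eq_sum _ (matA_pow_card hμ)]
  ext i k
  rw [Matrix.sum_apply]
  simp only [matA_pow hμ, Matrix.smul_apply, Matrix.of_apply, matL0, matL, charlier_zero,
    smul_eq_mul]
  split_ifs with h
  · have h' : (k : ℕ) ≤ i := h
    rw [Finset.sum_eq_single ((i : ℕ) - k)]
    · rw [if_pos (by omega)]
      ring
    · intro b _ hb
      rw [if_neg (by omega), mul_zero]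
    · intro hb
      simp only [Finset.mem_range] at hb
      omega
  · refine (Finset.sum_eq_zero fun b _ => ?_).symm
    rw [if_neg (by intro e; apply h; show (k : ℕ) ≤ i; omega), mul_zero]

theorem matL0_inv (hμ : ∀ j, 0 < μ j) :
    (matL0 a μ)⁻¹ = IsNilpotent.exp ((a : ℂ) • matA μ) := by
  refine Matrix.inv_eq_left_inv ?_
  rw [matL0_eq_exp hμ, neg_smul]
  exact IsNilpotent.exp_mul_exp_neg_self ((isNilpotent_matA hμ).smul _)

theorem matL0_mul_exp (hμ : ∀ j, 0 < μ j) :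
    matL0 a μ * IsNilpotent.exp ((a : ℂ) • matA μ) = 1 :=
  mul_eq_one_comm.1 (by
    rw [matL0_eq_exp hμ, neg_smul]
    exact IsNilpotent.exp_mul_exp_neg_self ((isNilpotent_matA hμ).smul _))

theorem exp_conjTranspose (hμ : ∀ j, 0 < μ j) :
    (IsNilpotent.exp ((a : ℂ) • matA μ)).conjTranspose =
      IsNilpotent.exp ((a : ℂ) • (matA μ).conjTranspose) := by
  rw [exp_smul_eq_sum _ (matA_pow_card hμ), exp_smul_eq_sum (k := N) _ (by
    rw [← Matrix.conjTranspose_pow, matA_pow_card hμ, Matrix.conjTranspose_zero]),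
    Matrix.conjTranspose_sum]
  refine Finset.sum_congr rfl fun i _ => ?_
  simp [Matrix.conjTranspose_smul, Matrix.conjTranspose_pow]

end Entries

/-! ### The diagonal factors `D_n` and the sum that gives `D_0` -/

section Norms

/-- Compare coefficients in `(1 - X)^{-(p+1)} (1 - X)^{-(q+1)} = (1 - X)^{-(p+q+2)}`. -/
theorem sum_choose_mul_choose (p q n : ℕ) :
    ∑ r ∈ Finset.range (n + 1), (p + r).choose p * (q + (n - r)).choose q =
      (p + q + 1 + n).choose n := by
  have h := congrArg (fun u : (PowerSeries ℤ)ˣ => PowerSeries.coeff n (u : PowerSeries ℤ))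
    (PowerSeries.invOneSubPow_add ℤ (p + 1) (q + 1))
  simp only [Units.val_mul, PowerSeries.coeff_mul] at h
  rw [show p + 1 + (q + 1) = p + q + 1 + 1 by ring,
    PowerSeries.invOneSubPow_val_succ_eq_mk_add_choose,
    PowerSeries.invOneSubPow_val_succ_eq_mk_add_choose,
    PowerSeries.invOneSubPow_val_succ_eq_mk_add_choose, PowerSeries.coeff_mk,
    Finset.Nat.sum_antidiagonal_eq_sum_range_succ_mk] at h
  simp only [PowerSeries.coeff_mk] at h
  rw [← Nat.choose_symm_add]
  exact_mod_cast h.symm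

/-- The diagonal entries of `D_n`, written with factorials. -/
def normEntry (N : ℕ) (a : ℝ) (lam n i : ℕ) : ℝ :=
  Real.exp a * n.factorial * a ^ n * (a / 2) ^ lam *
    ((lam + N - (i + 1)).factorial / i.factorial) *
    ((N + lam + n).factorial * (lam + n).factorial /
      ((N + lam + n - (i + 1)).factorial * (N + lam + n - i).factorial))

theorem normEntry_pos {a : ℝ} (ha : 0 < a) (N lam n i : ℕ) : 0 < normEntry N a lam n i := by
  unfold normEntry
  positivity

/-- The Pochhammer symbol at a negative integer carries the sign `(-1)^j`, which cancels the
explicit one; positivity becomes visible. -/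
theorem matD_eq (N : ℕ) (a : ℝ) (lam n : ℕ) :
    matD N a lam n = Matrix.diagonal fun i : Fin N => (normEntry N a lam n i : ℂ) := by
  rw [matD]
  congr 1
  ext i
  congr 1
  have h1 : (ascPochhammer ℝ ((i : ℕ) + 1)).eval (-(N : ℝ) - lam - n) =
      (-1) ^ ((i : ℕ) + 1) * ((N + lam + n).factorial / (N + lam + n - (i + 1)).factorial) := by
    rw [show -(N : ℝ) - lam - n = -((N + lam + n : ℕ) : ℝ) by push_cast; ring,
      ascPochhammer_eval_neg_eq_descPochhammer, descPochhammer_eval_eq_descFactorial,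
      ← Nat.factorial_mul_descFactorial (show (i : ℕ) + 1 ≤ N + lam + n by omega)]
    have := (N + lam + n - (i + 1)).factorial_ne_zero
    push_cast
    field_simp
  have h2 : (ascPochhammer ℝ (N - (i : ℕ))).eval ((lam : ℝ) + n + 1) =
      (N + lam + n - i).factorial / (lam + n).factorial := by
    rw [show (lam : ℝ) + n + 1 = ((lam + n + 1 : ℕ) : ℝ) by push_cast; ring,
      ← ascPochhammer_eval_cast, ascPochhammer_nat_eq_ascFactorial, eq_div_iff (by positivity),
      mul_comm, ← Nat.cast_mul, Nat.factorial_mul_ascFactorial]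
    congr 2
    omega
  rw [h1, h2, normEntry]
  have h3 := (N + lam + n - (i + 1)).factorial_ne_zero
  have h4 := (N + lam + n - i).factorial_ne_zero
  have h5 := (lam + n).factorial_ne_zero
  rcases neg_one_pow_eq_or ℝ ((i : ℕ) + 1) with e | e <;> rw [e] <;> field_simp

theorem normEntry_succ {N : ℕ} (a : ℝ) (lam n : ℕ) {i : ℕ} (hi : i < N) :
    (lam + N - i : ℝ) * normEntry N a lam (n + 1) i =
      2 * (n + 1) * normEntry N a (lam + 1) n i := by
  have e1 : lam + 1 + N - (i + 1) = lam + N - (i + 1) + 1 := by omega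
  have e2 : ((lam + N - (i + 1) : ℕ) : ℝ) = lam + N - i - 1 := by
    rw [Nat.cast_sub (by omega)]; push_cast; ring
  rw [normEntry, normEntry, e1, Nat.factorial_succ (lam + N - (i + 1)), Nat.factorial_succ n,
    show lam + 1 + n = lam + (n + 1) by ring, show N + (lam + 1) + n = N + lam + (n + 1) by ring,
    pow_succ, pow_succ]
  push_cast
  rw [e2]
  ring

theorem matD_succ (N : ℕ) (a : ℝ) (lam n : ℕ) :
    ((lam + N + 1 : ℂ) • 1 - matJ N) * matD N a lam (n + 1) =
      (2 * (n + 1) : ℂ) • matD N a (lam + 1) n := by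
  rw [matD_eq, matD_eq, matJ, ← Matrix.diagonal_one, ← Matrix.diagonal_smul, Matrix.diagonal_sub,
    Matrix.diagonal_mul_diagonal, ← Matrix.diagonal_smul]
  congr 1
  ext i
  have := congrArg (fun r : ℝ => (r : ℂ)) (normEntry_succ a lam n i.2)
  push_cast at this
  simp only [Pi.smul_apply, smul_eq_mul, ← this]
  push_cast
  ring

/-- The condition on `μ` turns the `r`-th term of the `i`-th entry into a constant times a product
of two binomials, and the sum over `r ≤ i` is `(N + lam).choose i`. -/
theorem matD_zero {N : ℕ} {a : ℝ} {μ : Fin N → ℝ} (ha : 0 < a) (hμ : ∀ j, 0 < μ j)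
    (hμ' : MuCondition a μ) (lam : ℕ) :
    ((Real.exp a : ℝ) : ℂ) • ∑ r ∈ Finset.range N, ((a : ℂ) ^ r / (r.factorial : ℂ)) •
      (matA μ ^ r * matT N a lam * (matA μ).conjTranspose ^ r) = matD N a lam 0 := by
  have h1 := fun r => matA_pow_mul_diagonal hμ r (fun i => ((delta a lam i : ℝ) : ℂ))
  simp only [matT, h1, matD_eq]
  ext i k
  simp only [Matrix.smul_apply, Matrix.sum_apply]
  by_cases hik : i = k
  swap
  · simp [Matrix.diagonal_apply_ne _ hik]
  subst hik
  simp only [Matrix.diagonal_apply_eq]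
  rw [← Finset.sum_subset (Finset.range_subset_range.2 (Nat.succ_le_of_lt i.2))]
  swap
  · intro r _ hr
    rw [dif_neg (by simp at hr; omega), smul_zero]
  have h2 : ∀ r ∈ Finset.range ((i : ℕ) + 1),
      ((a : ℂ) ^ r / (r.factorial : ℂ)) • (if h : r ≤ (i : ℕ) then
        (((μ i / μ ⟨i - r, by omega⟩) ^ 2 : ℝ) : ℂ) * ((delta a lam (i - r) : ℝ) : ℂ) else 0) =
      (((a / 2) ^ lam * lam.factorial * (((N - (i + 1) + r).choose (N - (i + 1)) *
        (lam + (i - r)).choose lam : ℕ) : ℝ) : ℝ) : ℂ) := by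
    intro r hr
    have hr' : r ≤ i := by simp at hr; omega
    have := hμ'.sq_mul ha (i := i) (k := ⟨i - r, by omega⟩) (r := r) (by simp only; omega)
    simp only at this
    rw [show N - (i - r + 1) = N - (i + 1) + r by omega] at this
    rw [dif_pos hr', delta, smul_eq_mul, ← Complex.ofReal_natCast r.factorial,
      ← Complex.ofReal_pow, ← Complex.ofReal_div, ← Complex.ofReal_mul, ← Complex.ofReal_mul]
    congr 1
    rw [Nat.cast_mul, Nat.cast_add_choose, Nat.cast_add_choose, ← this]
    have h3 := (N - (i + 1) : ℕ).factorial_ne_zero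
    have h4 := lam.factorial_ne_zero
    have h5 := (i - r : ℕ).factorial_ne_zero
    have h6 := r.factorial_ne_zero
    field_simp
  rw [Finset.sum_congr rfl h2, ← Complex.ofReal_sum, ← Finset.mul_sum, ← Nat.cast_sum,
    sum_choose_mul_choose, smul_eq_mul, ← Complex.ofReal_mul, normEntry]
  congr 1
  rw [show N - (i + 1) + lam + 1 + i = N + lam by omega, Nat.cast_choose ℝ (by omega)]
  rw [show lam + N - (i + 1) = N + lam - (i + 1) by omega]
  simp only [add_zero, Nat.factorial_zero, Nat.cast_one, pow_zero, mul_one]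
  have h3 := (N + lam - (i + 1)).factorial_ne_zero
  have h4 := (N + lam - i).factorial_ne_zero
  have h5 := (i : ℕ).factorial_ne_zero
  field_simp

end Norms

/-! ### Orthogonal polynomials, norms and subleading coefficients for the weight -/

section Weight

variable {N : ℕ} {a : ℝ} {μ : Fin N → ℝ}

theorem isHermitian_weight (a : ℝ) (μ : Fin N → ℝ) (lam x : ℕ) :
    (weight a μ lam x).IsHermitian := by
  rw [weight, Matrix.IsHermitian, Matrix.conjTranspose_smul, Matrix.conjTranspose_mul,
    Matrix.conjTranspose_mul, Matrix.conjTranspose_pow, Matrix.conjTranspose_pow, matT,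
    Matrix.diagonal_conjTranspose]
  simp only [Matrix.conjTranspose_add, Matrix.conjTranspose_one, Matrix.conjTranspose_conjTranspose,
    Complex.star_def, Complex.conj_ofReal, mul_assoc]
  congr 4
  ext i
  simp

theorem weight_eq (a : ℝ) (μ : Fin N → ℝ) (lam x : ℕ) :
    weight a μ lam x = ((a ^ x / (x.factorial : ℝ) : ℝ) : ℂ) • ((1 + matA μ) ^ x *
      ((1 + matA μ) ^ lam * matT N a lam * (1 + (matA μ).conjTranspose) ^ lam) *
        (1 + (matA μ).conjTranspose) ^ x) := by
  rw [weight, pow_add, add_comm x lam, pow_add (1 + (matA μ).conjTranspose)]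
  simp only [mul_assoc]

theorem exists_hasMoments_weight (ha : 0 < a) (hμ : ∀ j, 0 < μ j) (lam : ℕ) :
    ∃ m, HasMoments (weight a μ lam) m := by
  rw [funext (weight_eq a μ lam)]
  exact exists_hasMoments_conj_pow ha (isNilpotent_matA hμ)
    (isNilpotent_conjTranspose (isNilpotent_matA hμ)) _

/-- The square norms `L₀⁻¹ (1 + A) ^ (n + lam) D_n (1 + A^*) ^ (n + lam) (L₀^*)⁻¹`, written with
the exponential of `A`. -/
def squareNorm (a : ℝ) (μ : Fin N → ℝ) (lam n : ℕ) : Mat N :=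
  IsNilpotent.exp ((a : ℂ) • matA μ) * (1 + matA μ) ^ (n + lam) * matD N a lam n *
    (1 + (matA μ).conjTranspose) ^ (n + lam) * IsNilpotent.exp ((a : ℂ) • (matA μ).conjTranspose)

theorem squareNorm_eq (hμ : ∀ j, 0 < μ j) (lam n : ℕ) :
    squareNorm a μ lam n = (matL0 a μ)⁻¹ * (1 + matA μ) ^ (n + lam) * matD N a lam n *
      (1 + (matA μ).conjTranspose) ^ (n + lam) * ((matL0 a μ).conjTranspose)⁻¹ := by
  rw [← Matrix.conjTranspose_nonsing_inv, matL0_inv hμ, exp_conjTranspose hμ, squareNorm]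

theorem isUnit_one_add_matA (hμ : ∀ j, 0 < μ j) : IsUnit (1 + matA μ) :=
  (isNilpotent_matA hμ).isUnit_one_add

theorem isUnit_exp_mul_pow (hμ : ∀ j, 0 < μ j) (k : ℕ) :
    IsUnit (IsNilpotent.exp ((a : ℂ) • matA μ) * (1 + matA μ) ^ k) :=
  (IsUnit.of_mul_eq_one_right _ (matL0_mul_exp (a := a) hμ)).mul ((isUnit_one_add_matA hμ).pow k)

theorem posDef_matD (ha : 0 < a) (lam n : ℕ) : (matD N a lam n).PosDef := by
  rw [matD_eq]
  exact Matrix.PosDef.diagonal fun i => by exact_mod_cast normEntry_pos ha N lam n i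

theorem posDef_squareNorm (ha : 0 < a) (hμ : ∀ j, 0 < μ j) (lam n : ℕ) :
    (squareNorm a μ lam n).PosDef := by
  have h := (posDef_matD ha lam n).mul_mul_conjTranspose_same
    (B := IsNilpotent.exp ((a : ℂ) • matA μ) * (1 + matA μ) ^ (n + lam))
    (Matrix.vecMul_injective_of_isUnit (isUnit_exp_mul_pow hμ _))
  rw [Matrix.conjTranspose_mul, exp_conjTranspose hμ, Matrix.conjTranspose_pow,
    Matrix.conjTranspose_add, Matrix.conjTranspose_one, ← mul_assoc] at h
  exact h

theorem hasSum_weight (ha : 0 < a) (hμ : ∀ j, 0 < μ j) (hμ' : MuCondition a μ) (lam : ℕ) :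
    HasSum (weight a μ lam) (squareNorm a μ lam 0) := by
  have h := hasSum_conj_pow a (matA_pow_card hμ)
    (isNilpotent_conjTranspose (isNilpotent_matA hμ))
    ((1 + matA μ) ^ lam * matT N a lam * (1 + (matA μ).conjTranspose) ^ lam)
  rw [funext (weight_eq a μ lam)]
  convert h using 1
  -- The outer powers commute with `A ^ r` and `(A^*) ^ r`, so they leave the sum and `D_0` remains
  -- inside.
  have hA : ∀ r, Commute (matA μ ^ r) ((1 + matA μ) ^ lam) := fun r =>
    (((Commute.one_right _).add_right (Commute.refl (matA μ))).pow_pow r lam)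
  have hE : ∀ r, Commute ((1 + (matA μ).conjTranspose) ^ lam) ((matA μ).conjTranspose ^ r) :=
    fun r => (((Commute.one_left _).add_left (Commute.refl _)).pow_pow lam r)
  have e : ∀ r, matA μ ^ r * ((1 + matA μ) ^ lam * matT N a lam *
      (1 + (matA μ).conjTranspose) ^ lam) * (matA μ).conjTranspose ^ r =
      (1 + matA μ) ^ lam * (matA μ ^ r * matT N a lam * (matA μ).conjTranspose ^ r) *
        (1 + (matA μ).conjTranspose) ^ lam := fun r => by
    rw [← mul_assoc, ← mul_assoc, (hA r).eq, mul_assoc _ _ ((matA μ).conjTranspose ^ r), (hE r).eq]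
    simp only [mul_assoc]
  simp only [e]
  have e2 : ∑ r ∈ Finset.range N, ((a : ℂ) ^ r / (r.factorial : ℂ)) • ((1 + matA μ) ^ lam *
      (matA μ ^ r * matT N a lam * (matA μ).conjTranspose ^ r) *
        (1 + (matA μ).conjTranspose) ^ lam) = (1 + matA μ) ^ lam *
      (∑ r ∈ Finset.range N, ((a : ℂ) ^ r / (r.factorial : ℂ)) •
        (matA μ ^ r * matT N a lam * (matA μ).conjTranspose ^ r)) *
          (1 + (matA μ).conjTranspose) ^ lam := by
    simp only [Finset.mul_sum, Finset.sum_mul, mul_smul_comm, smul_mul_assoc]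
  rw [e2, squareNorm, ← matD_zero ha hμ hμ', zero_add]
  simp only [mul_smul_comm, smul_mul_assoc, mul_assoc]

theorem Phi_mul_weight (ha : 0 < a) (hμ : ∀ j, 0 < μ j) (hμ' : MuCondition a μ) (lam x : ℕ) :
    (LadderRelations.quadratic (matA μ) (1 + matA μ)⁻¹ * (x : Mat N) ^ 2 +
      LadderRelations.linear (a : ℂ) (matA μ) (matH N a) (1 + matA μ)⁻¹ lam * x +
      LadderRelations.constant (a : ℂ) (matA μ) (matJ N) (matJ N * (matA μ).conjTranspose)
        (matH N a) (1 + matA μ)⁻¹ lam) * weight a μ lam x = weight a μ (lam + 1) x := by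
  rw [weight, mul_smul_comm, (ladderRelations ha hμ hμ').Phi_mul (matT_succ lam)
    (matT_succ_mul lam), weight]

theorem Psi_mul_weight (ha : 0 < a) (hμ : ∀ j, 0 < μ j) (hμ' : MuCondition a μ) (lam x : ℕ) :
    (LadderRelations.quadratic (matA μ) (1 + matA μ)⁻¹ * ((x : Mat N) + 1) ^ 2 +
      LadderRelations.linear' (matA μ) (matJ N) (1 + matA μ)⁻¹ lam * (x + 1)) *
        weight a μ lam (x + 1) = weight a μ (lam + 1) x := by
  have h := (ladderRelations ha hμ hμ').Psi_mul (E := (matA μ).conjTranspose)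
    (matT_succ (N := N) (a := a) lam) (x + 1)
  rw [Nat.cast_succ (R := Mat N)] at h
  rw [weight, mul_smul_comm, h, weight, smul_smul, show x + 1 + lam = x + (lam + 1) by ring,
    Nat.factorial_succ]
  congr 1
  have : (a : ℂ) ≠ 0 := Complex.ofReal_ne_zero.2 ha.ne'
  push_cast
  field_simp
  ring

theorem isUnit_shifted_matJ (N lam : ℕ) : IsUnit ((lam + N + 1 : ℂ) • (1 : Mat N) - matJ N) := by
  rw [matJ, ← Matrix.diagonal_one, ← Matrix.diagonal_smul, Matrix.diagonal_sub,
    Matrix.isUnit_diagonal, Pi.isUnit_iff]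
  intro i
  rw [isUnit_iff_ne_zero]
  simp only [Pi.smul_apply, smul_eq_mul, mul_one]
  have h : (lam + N + 1 : ℂ) - ((i + 1 : ℕ) : ℂ) = ((lam + N - i : ℕ) : ℂ) := by
    rw [Nat.cast_sub (by omega)]; push_cast; ring
  rw [h]
  exact Nat.cast_ne_zero.2 (by omega)

/-- The leading coefficient produced by the raising operator for the weight `W^{(lam)}`. -/
def leadingMat (a : ℝ) (μ : Fin N → ℝ) (lam n : ℕ) : Mat N :=
  LadderRelations.leading (a : ℂ) (matA μ) (matJ N) (1 + matA μ)⁻¹ N lam n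

theorem leadingMat_mul (ha : 0 < a) (hμ : ∀ j, 0 < μ j) (hμ' : MuCondition a μ) (lam n : ℕ) :
    leadingMat a μ lam n * (IsNilpotent.exp ((a : ℂ) • matA μ) * (1 + matA μ) ^ (n + 1 + lam)) =
      (-1 / 2 : ℂ) • (IsNilpotent.exp ((a : ℂ) • matA μ) * (1 + matA μ) ^ (n + 1 + lam) *
        ((lam + N + 1 : ℂ) • 1 - matJ N)) :=
  (ladderRelations ha hμ hμ').leading_mul (isNilpotent_matA hμ) N lam n

theorem isUnit_leadingMat (ha : 0 < a) (hμ : ∀ j, 0 < μ j) (hμ' : MuCondition a μ) (lam n : ℕ) :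
    IsUnit (leadingMat a μ lam n) := by
  have hg := isUnit_exp_mul_pow (a := a) hμ (n + 1 + lam)
  rw [← hg.mul_right_iff, leadingMat_mul ha hμ hμ', ← mul_smul_comm, hg.mul_left_iff]
  exact (isUnit_smul_iff (Units.mk0 (-1 / 2 : ℂ) (by norm_num)) _).2 (isUnit_shifted_matJ N lam)

/-- `K_n` passes through `g` as a diagonal matrix, where `matD_succ` applies. Both norms contain the
same `g`, because `n + (lam + 1) = (n + 1) + lam`. -/
theorem leadingMat_mul_squareNorm (ha : 0 < a) (hμ : ∀ j, 0 < μ j) (hμ' : MuCondition a μ)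
    (lam n : ℕ) :
    leadingMat a μ lam n * squareNorm a μ lam (n + 1) =
      -((n + 1 : ℂ) • squareNorm a μ (lam + 1) n) := by
  rw [squareNorm, squareNorm, ← mul_assoc, ← mul_assoc, ← mul_assoc, leadingMat_mul ha hμ hμ',
    smul_mul_assoc, mul_assoc (IsNilpotent.exp ((a : ℂ) • matA μ) * _) _ (matD N a lam (n + 1)),
    matD_succ, show n + (lam + 1) = n + 1 + lam by ring]
  simp only [mul_smul_comm, smul_mul_assoc, mul_assoc, smul_smul, ← neg_smul]
  congr 1
  ring

theorem raise_weight [NeZero N] (ha : 0 < a) (hμ : ∀ j, 0 < μ j) (hμ' : MuCondition a μ)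
    {lam n : ℕ} {P : (Mat N)[X]}
    (h : IsOrthogonal (weight a μ (lam + 1)) P n (squareNorm a μ (lam + 1) n)) :
    IsOrthogonal (weight a μ lam) (C (leadingMat a μ lam n)⁻¹ *
      raise (LadderRelations.quadratic (matA μ) (1 + matA μ)⁻¹)
        (LadderRelations.linear (a : ℂ) (matA μ) (matH N a) (1 + matA μ)⁻¹ lam)
        (LadderRelations.constant (a : ℂ) (matA μ) (matJ N) (matJ N * (matA μ).conjTranspose)
          (matH N a) (1 + matA μ)⁻¹ lam)
        (LadderRelations.linear' (matA μ) (matJ N) (1 + matA μ)⁻¹ lam) P) (n + 1)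
      (squareNorm a μ lam (n + 1)) := by
  obtain ⟨m, hm⟩ := exists_hasMoments_weight ha hμ (lam + 1)
  have hu := Matrix.nonsing_inv_mul _
    ((Matrix.isUnit_iff_isUnit_det _).1 (isUnit_leadingMat ha hμ hμ' lam n))
  have := h.raise (Phi_mul_weight ha hμ hμ' lam) (Psi_mul_weight ha hμ hμ' lam) hm
    (LadderRelations.leading_eq (Complex.ofReal_ne_zero.2 ha.ne') rfl lam n) hu
  rwa [← leadingMat_mul_squareNorm ha hμ hμ', ← mul_assoc, hu, one_mul] at this

theorem isOrthogonal_weight_one [NeZero N] (ha : 0 < a) (hμ : ∀ j, 0 < μ j)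
    (hμ' : MuCondition a μ) (lam : ℕ) :
    IsOrthogonal (weight a μ lam) 1 0 (squareNorm a μ lam 0) where
  monic := monic_one
  natDegree_eq := natDegree_one
  moment_lt m hm := absurd hm (Nat.not_lt_zero m)
  moment_self := by simpa using hasSum_weight ha hμ hμ' lam

/-- The induction needs all `lam` at once: degree `n + 1` at `lam` is raised from degree `n` at `lam
+ 1`. -/
theorem exists_isOrthogonal_weight [NeZero N] (ha : 0 < a) (hμ : ∀ j, 0 < μ j)
    (hμ' : MuCondition a μ) (n lam : ℕ) :
    ∃ P, IsOrthogonal (weight a μ lam) P n (squareNorm a μ lam n) := by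
  induction n generalizing lam with
  | zero => exact ⟨1, isOrthogonal_weight_one ha hμ hμ' lam⟩
  | succ n ih =>
    obtain ⟨P, hP⟩ := ih (lam + 1)
    exact ⟨_, raise_weight ha hμ hμ' hP⟩

theorem IsOrthogonal.weight_unique [NeZero N] (ha : 0 < a) (hμ : ∀ j, 0 < μ j)
    (hμ' : MuCondition a μ) {lam n : ℕ} {P Q : (Mat N)[X]} {H H' : Mat N}
    (hP : IsOrthogonal (weight a μ lam) P n H) (hQ : IsOrthogonal (weight a μ lam) Q n H') :
    P = Q := by
  choose S hS using fun n => exists_isOrthogonal_weight ha hμ hμ' n lam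
  refine sub_eq_zero.1 (eq_zero_of_moments (isHermitian_weight a μ lam)
    (posDef_squareNorm ha hμ lam) hS (n := n) ?_ ?_)
  · intro j hj
    rcases eq_or_lt_of_le hj with rfl | hj
    · rw [coeff_sub, hP.coeff_self, hQ.coeff_self, sub_self]
    · rw [coeff_sub, coeff_eq_zero_of_natDegree_lt (by rw [hP.natDegree_eq]; exact hj),
        coeff_eq_zero_of_natDegree_lt (by rw [hQ.natDegree_eq]; exact hj), sub_self]
  · intro m hm
    simpa [map_sub, sub_mul, smul_sub] using (hP.moment_lt m hm).sub (hQ.moment_lt m hm)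

/-- The constant coefficient of the monic orthogonal polynomial of degree one. -/
def firstCoeff (a : ℝ) (μ : Fin N → ℝ) (lam : ℕ) : Mat N :=
  (-a : ℂ) • (IsNilpotent.exp ((a : ℂ) • matA μ) *
    ((1 + matA μ) ^ (lam + 1) * calA μ (lam + 1) * (1 + matA μ)⁻¹ ^ lam + (1 + matA μ)) *
      matL0 a μ)

theorem mul_calA (μ : Fin N → ℝ) (lam : ℕ) :
    ((lam + N + 1 : ℂ) • 1 - matJ N) * calA μ (lam + 1) = matJ N * (matA μ).conjTranspose := by
  have h : ((N + (lam + 1) : ℕ) : Mat N) = (lam + N + 1 : ℂ) • 1 := by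
    rw [natCast_eq_smul_one]
    congr 1
    push_cast
    ring
  rw [calA, h, ← mul_assoc, ← mul_assoc, Matrix.mul_nonsing_inv _
    ((Matrix.isUnit_iff_isUnit_det _).1 (isUnit_shifted_matJ N lam)), one_mul]

theorem inv_pow_mul_pow (hμ : ∀ j, 0 < μ j) (k : ℕ) :
    (1 + matA μ)⁻¹ ^ k * (1 + matA μ) ^ k = 1 := by
  rw [Matrix.inv_pow', Matrix.nonsing_inv_mul _
    ((Matrix.isUnit_iff_isUnit_det _).1 ((isUnit_one_add_matA hμ).pow k))]

theorem pow_mul_inv_pow (hμ : ∀ j, 0 < μ j) (k : ℕ) :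
    (1 + matA μ) ^ k * (1 + matA μ)⁻¹ ^ k = 1 :=
  mul_eq_one_comm.1 (inv_pow_mul_pow hμ k)

theorem commute_exp_pow (hμ : ∀ j, 0 < μ j) (k : ℕ) :
    Commute ((1 + matA μ) ^ k) (IsNilpotent.exp ((a : ℂ) • matA μ)) := by
  rw [exp_smul_eq_sum _ (matA_pow_card hμ)]
  refine Commute.sum_right _ _ _ fun i _ => Commute.smul_right ?_ _
  exact ((Commute.one_left _).add_left (Commute.refl _)).pow_pow k i

/-- Raising the constant `1` gives constant coefficient `K_0⁻¹ Φ(0)`. The closed form is checked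
after right multiplication by `e^{aA}(1 + A)^lam`, where `exp_mul_add` is exactly what remains. -/
theorem leadingMat_mul_firstCoeff (ha : 0 < a) (hμ : ∀ j, 0 < μ j) (hμ' : MuCondition a μ)
    (lam : ℕ) :
    leadingMat a μ lam 0 * firstCoeff a μ lam =
      LadderRelations.constant (a : ℂ) (matA μ) (matJ N) (matJ N * (matA μ).conjTranspose)
        (matH N a) (1 + matA μ)⁻¹ lam := by
  have hrel := ladderRelations ha hμ hμ'
  refine (isUnit_exp_mul_pow (a := a) hμ lam).mul_right_cancel ?_
  have hlead := leadingMat_mul ha hμ hμ' lam 0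
  rw [zero_add, add_comm 1 lam] at hlead
  set e := IsNilpotent.exp ((a : ℂ) • matA μ) with he
  have hLe : matL0 a μ * e = 1 := matL0_mul_exp hμ
  have h1 : firstCoeff a μ lam * (e * (1 + matA μ) ^ lam) =
      (-a : ℂ) • (e * (1 + matA μ) ^ (lam + 1) * (calA μ (lam + 1) + 1)) := by
    rw [firstCoeff, smul_mul_assoc, ← mul_assoc, ← he, mul_assoc _ (matL0 a μ), hLe, mul_one,
      mul_assoc e, add_mul, mul_assoc _ (_⁻¹ ^ lam), inv_pow_mul_pow hμ, mul_one, mul_add,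
      mul_add (e * _), mul_one, ← pow_succ', mul_assoc]
  have h2 := hrel.exp_mul_add (isNilpotent_matA hμ) rfl lam
  rw [mul_assoc (leadingMat a μ lam 0), h1, mul_smul_comm, ← mul_assoc, hlead, smul_mul_assoc,
    mul_assoc, mul_add _ (calA μ (lam + 1)), mul_calA, mul_one, ← (commute_exp_pow hμ lam).eq,
    ← mul_assoc, hrel.constant_mul_pow, smul_mul_assoc, mul_assoc _ _ e, ← h2, ← mul_assoc,
    (commute_exp_pow hμ (lam + 1)).eq, smul_smul]
  congr 1
  ring

theorem coeff_zero_of_isOrthogonal [NeZero N] (ha : 0 < a) (hμ : ∀ j, 0 < μ j)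
    (hμ' : MuCondition a μ) {lam : ℕ} {P : (Mat N)[X]} {H : Mat N}
    (hP : IsOrthogonal (weight a μ lam) P 1 H) : P.coeff 0 = firstCoeff a μ lam := by
  have h := raise_weight ha hμ hμ' (isOrthogonal_weight_one ha hμ hμ' (lam + 1))
  rw [zero_add] at h
  rw [hP.weight_unique ha hμ hμ' h, coeff_C_mul, coeff_zero_raise_one,
    ← leadingMat_mul_firstCoeff ha hμ hμ', ← mul_assoc, Matrix.nonsing_inv_mul _
    ((Matrix.isUnit_iff_isUnit_det _).1 (isUnit_leadingMat ha hμ hμ' lam 0)), one_mul]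

/-- Taking forward differences lowers the degree and raises `lam` until degree one at `lam + n`. The
quadratic correction collects the second-order binomial terms of the shift. -/
theorem subleading_of_isOrthogonal [NeZero N] (ha : 0 < a) (hμ : ∀ j, 0 < μ j)
    (hμ' : MuCondition a μ) (n : ℕ) {lam : ℕ} {P : (Mat N)[X]} {H : Mat N}
    (hP : IsOrthogonal (weight a μ lam) P (n + 1) H) :
    P.coeff n = (n + 1 : ℂ) • firstCoeff a μ (lam + n) - ((n + 1) * n / 2 : ℂ) • 1 := by
  induction n generalizing lam P H with
  | zero => simpa using coeff_zero_of_isOrthogonal ha hμ hμ' hP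
  | succ n ih =>
    obtain ⟨m, hm⟩ := exists_hasMoments_weight ha hμ (lam + 1)
    choose S hS using fun n => exists_isOrthogonal_weight ha hμ hμ' n (lam + 1)
    have h := hP.shift_sub (Phi_mul_weight ha hμ hμ' lam) (Psi_mul_weight ha hμ hμ' lam) hm
      (isHermitian_weight a μ lam) (isHermitian_weight a μ (lam + 1))
      (posDef_squareNorm ha hμ (lam + 1)) hS
    have h1 := congrArg (fun Q => Q.coeff n) h
    simp only [coeff_sub, coeff_C_mul] at h1
    have hc : ((n + 2).choose n : ℂ) = (n + 2) * (n + 1) / 2 := by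
      rw [Nat.choose_symm_add, Nat.cast_choose_two]
      push_cast
      ring
    rw [coeff_shift_pred_pred _ hP.natDegree_eq.le, hP.coeff_self, ih (hS (n + 1)),
      Int.cast_one, one_mul, one_pow, one_mul, one_mul, add_assoc, add_sub_cancel_left,
      mul_natCast_eq_smul, natCast_mul_eq_smul, natCast_eq_smul_one (R := Mat N), hc,
      show lam + 1 + n = lam + (n + 1) by ring] at h1
    have hn : ((n + 1 : ℕ) : ℂ) ≠ 0 := Nat.cast_ne_zero.2 n.succ_ne_zero
    rw [← eq_sub_iff_add_eq] at h1
    have h2 : P.coeff (n + 1) = (((n + 1 : ℕ) : ℂ))⁻¹ • (((n + 1 : ℕ) : ℂ) • P.coeff (n + 1)) := by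
      rw [smul_smul, inv_mul_cancel₀ hn, one_smul]
    rw [h2, h1]
    push_cast at hn ⊢
    match_scalars <;> field_simp
    ring

theorem zpow_neg_eq_inv_pow (M : Mat N) (k : ℕ) : M ^ (-(k : ℤ)) = M⁻¹ ^ k := by
  rw [Matrix.zpow_neg_natCast, Matrix.inv_pow']

theorem formulaB_eq (hμ : ∀ j, 0 < μ j) (lam n : ℕ) :
    formulaB a μ lam n = (a : ℂ) • (IsNilpotent.exp ((a : ℂ) • matA μ) * ((n + 1 : ℂ) •
      ((1 + matA μ) ^ (n + lam + 1) * calA μ (n + lam + 1) * (1 + matA μ)⁻¹ ^ (n + lam)) -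
      (n : ℂ) • ((1 + matA μ) ^ (n + lam) * calA μ (n + lam) *
        ((1 + matA μ) * (1 + matA μ)⁻¹ ^ (n + lam))) + (1 + matA μ) + (n / a : ℂ) • 1) *
          matL0 a μ) := by
  have hU : (1 + matA μ) ^ (n + lam) * ((1 + matA μ) * (1 + matA μ)⁻¹ ^ (n + lam)) =
      1 + matA μ := by
    rw [← mul_assoc, ← pow_succ, pow_succ', mul_assoc, pow_mul_inv_pow hμ, mul_one]
  have key : ∀ X Y : Mat N, (1 + matA μ) ^ (n + lam) * ((n + 1 : ℂ) • ((1 + matA μ) * X) -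
      (n : ℂ) • (Y * (1 + matA μ)) + 1 + matA μ + (n / a : ℂ) • 1) * (1 + matA μ)⁻¹ ^ (n + lam) =
      (n + 1 : ℂ) • ((1 + matA μ) ^ (n + lam + 1) * X * (1 + matA μ)⁻¹ ^ (n + lam)) -
      (n : ℂ) • ((1 + matA μ) ^ (n + lam) * Y * ((1 + matA μ) * (1 + matA μ)⁻¹ ^ (n + lam))) +
        (1 + matA μ) + (n / a : ℂ) • 1 := fun X Y => by
    have hU' := pow_mul_inv_pow hμ (n + lam)
    rw [add_assoc _ 1 (matA μ), pow_succ]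
    generalize 1 + matA μ = U at *
    simp only [mul_add, mul_sub, add_mul, sub_mul, mul_smul_comm, smul_mul_assoc, mul_one, hU',
      mul_assoc, hU]
  rw [formulaB, matL0_inv hμ, show -(lam : ℤ) - (n : ℤ) = -((n + lam : ℕ) : ℤ) by push_cast; ring,
    zpow_neg_eq_inv_pow, mul_assoc _ ((1 + matA μ) ^ (n + lam)), mul_assoc _ (_ * _) (_⁻¹ ^ _), key]

theorem formulaC_mul_squareNorm (ha : 0 < a) (hμ : ∀ j, 0 < μ j) (lam n : ℕ) :
    formulaC a μ lam (n + 1) * squareNorm a μ lam n = squareNorm a μ lam (n + 1) := by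
  have hD := Matrix.nonsing_inv_mul _
    ((Matrix.isUnit_iff_isUnit_det _).1 (posDef_matD (N := N) ha lam n).isUnit)
  rw [formulaC, squareNorm, squareNorm, matL0_inv hμ, Nat.add_sub_cancel,
    show -((n + 1 : ℕ) : ℤ) - (lam : ℤ) + 1 = -((n + lam : ℕ) : ℤ) by push_cast; ring,
    zpow_neg_eq_inv_pow]
  simp only [← mul_assoc]
  rw [mul_assoc _ (matL0 a μ), matL0_mul_exp hμ, mul_one, mul_assoc _ (_⁻¹ ^ _),
    inv_pow_mul_pow hμ, mul_one, mul_assoc _ (_⁻¹) (matD N a lam n), hD, mul_one,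
    mul_assoc _ _ ((1 + (matA μ).conjTranspose) ^ _), ← pow_succ',
    show n + lam + 1 = n + 1 + lam by ring]

end Weight

/-! ### The coefficient `B_n` -/

section Recurrence

variable {N : ℕ} {a : ℝ} {μ : Fin N → ℝ}

theorem coeff_sub_coeff_eq_formulaB [NeZero N] (ha : 0 < a) (hμ : ∀ j, 0 < μ j)
    (hμ' : MuCondition a μ) {lam : ℕ} {P : ℕ → (Mat N)[X]} {H : ℕ → Mat N}
    (hP : ∀ n, IsOrthogonal (weight a μ lam) (P n) n (H n)) (n : ℕ) :
    (X * P n).coeff n - (P (n + 1)).coeff n = formulaB a μ lam n := by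
  have ha' : (a : ℂ) ≠ 0 := Complex.ofReal_ne_zero.2 ha.ne'
  rw [subleading_of_isOrthogonal ha hμ hμ' n (hP (n + 1)), formulaB_eq hμ]
  -- For `n = 0` the product `X * P 0` has no constant term, so only one subleading coefficient
  -- enters.
  cases n with
  | zero => simp [firstCoeff]
  | succ n =>
    have hU : (1 + matA μ) * (1 + matA μ)⁻¹ ^ (n + 1 + lam) = (1 + matA μ)⁻¹ ^ (lam + n) := by
      rw [show n + 1 + lam = lam + n + 1 by ring, pow_succ', ← mul_assoc, Matrix.mul_nonsing_inv _
        ((Matrix.isUnit_iff_isUnit_det _).1 (isUnit_one_add_matA hμ)), one_mul]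
    have hL := mul_eq_one_comm.1 (matL0_mul_exp (a := a) hμ)
    rw [coeff_X_mul, subleading_of_isOrthogonal ha hμ hμ' n (hP (n + 1)), firstCoeff, firstCoeff,
      hU, show n + 1 + lam + 1 = lam + (n + 1) + 1 by ring,
      show n + 1 + lam = lam + n + 1 by ring, show lam + (n + 1) = lam + n + 1 by ring]
    generalize IsNilpotent.exp ((a : ℂ) • matA μ) = e at *
    generalize 1 + matA μ = U at *
    simp only [mul_add, mul_sub, add_mul, sub_mul, mul_smul_comm, smul_mul_assoc, mul_one, hL]
    push_cast
    match_scalars <;> field_simp <;> ring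

end Recurrence

/-! ### Rational dependence of `C_n` on `n` -/

section Rational

/-- `f` is the restriction to `ℕ` of a rational function without poles in `ℕ`. -/
def IsRationalSeq (f : ℕ → ℂ) : Prop :=
  ∃ r : RatFunc ℂ, ∀ n : ℕ, r.denom.eval (n : ℂ) ≠ 0 ∧ r.eval (RingHom.id ℂ) n = f n

namespace IsRationalSeq

variable {f g : ℕ → ℂ}

theorem add (hf : IsRationalSeq f) (hg : IsRationalSeq g) :
    IsRationalSeq fun n => f n + g n := by
  obtain ⟨r, hr⟩ := hf
  obtain ⟨s, hs⟩ := hg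
  refine ⟨r + s, fun n => ⟨fun h => ?_, ?_⟩⟩
  · have := eval_eq_zero_of_dvd_of_eval_eq_zero (RatFunc.denom_add_dvd r s) h
    rw [eval_mul] at this
    exact (mul_ne_zero (hr n).1 (hs n).1) this
  · rw [RatFunc.eval_add _ _ (hr n).1 (hs n).1, (hr n).2, (hs n).2]

theorem mul (hf : IsRationalSeq f) (hg : IsRationalSeq g) :
    IsRationalSeq fun n => f n * g n := by
  obtain ⟨r, hr⟩ := hf
  obtain ⟨s, hs⟩ := hg
  refine ⟨r * s, fun n => ⟨fun h => ?_, ?_⟩⟩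
  · have := eval_eq_zero_of_dvd_of_eval_eq_zero (RatFunc.denom_mul_dvd r s) h
    rw [eval_mul] at this
    exact (mul_ne_zero (hr n).1 (hs n).1) this
  · rw [RatFunc.eval_mul _ _ (hr n).1 (hs n).1, (hr n).2, (hs n).2]

theorem polynomial (p : ℂ[X]) : IsRationalSeq fun n => p.eval (n : ℂ) :=
  ⟨algebraMap ℂ[X] (RatFunc ℂ) p, fun n => ⟨by simp, by simp [RatFunc.eval_algebraMap]⟩⟩

theorem const (c : ℂ) : IsRationalSeq fun _ => c := by
  simpa using polynomial (C c)

theorem natCast_add (c : ℂ) : IsRationalSeq fun n => (n : ℂ) + c := by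
  have h : ∀ n : ℕ, (X + C c).eval (n : ℂ) = n + c := fun n => by rw [eval_add, eval_X, eval_C]
  exact (funext h : (fun n : ℕ => (X + C c).eval (n : ℂ)) = _) ▸ polynomial (X + C c)

theorem sum {ι : Type*} (s : Finset ι) {F : ι → ℕ → ℂ} (h : ∀ i ∈ s, IsRationalSeq (F i)) :
    IsRationalSeq fun n => ∑ i ∈ s, F i n := by
  classical
  induction s using Finset.induction_on with
  | empty => simpa using const 0
  | insert i s hi ih =>
    simp only [Finset.sum_insert hi]
    exact (h i (Finset.mem_insert_self _ _)).add
      (ih fun j hj => h j (Finset.mem_insert_of_mem hj))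

theorem inv_natCast_add {c : ℕ} (hc : 0 < c) : IsRationalSeq fun n => ((n : ℂ) + c)⁻¹ := by
  have hne : ∀ n : ℕ, (n : ℂ) + c ≠ 0 := fun n => by exact_mod_cast (by omega : n + c ≠ 0)
  set q : ℂ[X] := X + C (c : ℂ) with hq
  have hqn : ∀ n : ℕ, q.eval (n : ℂ) = n + c := fun n => by simp [hq]
  have hd : ∀ n : ℕ, (algebraMap ℂ[X] (RatFunc ℂ) 1 / algebraMap ℂ[X] (RatFunc ℂ) q).denom.eval
      (n : ℂ) ≠ 0 := fun n h => by
    have := eval_eq_zero_of_dvd_of_eval_eq_zero (RatFunc.denom_div_dvd 1 q) h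
    rw [hqn] at this
    exact hne n this
  have hq0 : algebraMap ℂ[X] (RatFunc ℂ) q ≠ 0 := by
    exact RatFunc.algebraMap_ne_zero (X_add_C_ne_zero _)
  refine ⟨_, fun n => ⟨hd n, ?_⟩⟩
  have h1 := RatFunc.eval_mul (RingHom.id ℂ) (n : ℂ)
    (x := algebraMap ℂ[X] (RatFunc ℂ) 1 / algebraMap ℂ[X] (RatFunc ℂ) q)
    (y := algebraMap ℂ[X] (RatFunc ℂ) q) (hd n) (by simp)
  rw [div_mul_cancel₀ _ hq0, RatFunc.eval_algebraMap, RatFunc.eval_algebraMap] at h1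
  simp only [Algebra.algebraMap_self, RingHom.id_apply, eval₂_id, eval_one, hqn] at h1
  exact eq_inv_of_mul_eq_one_left h1.symm

theorem choose (c k : ℕ) : IsRationalSeq fun n => ((n + c).choose k : ℂ) := by
  have h := (polynomial ((descPochhammer ℂ k).comp (X + C (c : ℂ)))).mul
    (const ((k.factorial : ℂ)⁻¹))
  convert h using 2 with n
  rw [eval_comp, eval_add, eval_X, eval_C, ← Nat.cast_add, descPochhammer_eval_eq_descFactorial,
    Nat.descFactorial_eq_factorial_mul_choose, Nat.cast_mul]
  have := k.factorial_ne_zero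
  field_simp

end IsRationalSeq

/-- All entries are rational sequences. -/
def IsRationalMatSeq {N : ℕ} (M : ℕ → Mat N) : Prop :=
  ∀ i j, IsRationalSeq fun n => M n i j

namespace IsRationalMatSeq

variable {N : ℕ}

theorem const (M : Mat N) : IsRationalMatSeq fun _ => M :=
  fun i j => IsRationalSeq.const (M i j)

theorem mul {M L : ℕ → Mat N} (hM : IsRationalMatSeq M) (hL : IsRationalMatSeq L) :
    IsRationalMatSeq fun n => M n * L n := fun i j => by
  simp only [Matrix.mul_apply]
  exact IsRationalSeq.sum _ fun k _ => (hM i k).mul (hL k j)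

theorem one_add_pow {A : Mat N} {K : ℕ} (hA : A ^ K = 0) (c : ℕ) :
    IsRationalMatSeq fun n => (1 + A) ^ (n + c) := fun i j => by
  simp only [one_add_pow_eq_sum hA, Matrix.sum_apply, Matrix.smul_apply, smul_eq_mul]
  exact IsRationalSeq.sum _ fun k _ => (IsRationalSeq.choose c k).mul (.const _)

end IsRationalMatSeq

/-- After cross-multiplication, two polynomials agree at infinitely many points. -/
theorem RatFunc.eq_of_eval_natCast_eq {r s : RatFunc ℂ}
    (h : ∀ n : ℕ, 1 ≤ n → r.denom.eval (n : ℂ) ≠ 0 ∧ s.denom.eval (n : ℂ) ≠ 0 ∧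
      r.eval (RingHom.id ℂ) n = s.eval (RingHom.id ℂ) n) : r = s := by
  have hp : r.num * s.denom = s.num * r.denom := by
    refine eq_of_infinite_eval_eq _ _ (Set.Infinite.mono (s := Set.range fun n : ℕ =>
      ((n + 1 : ℕ) : ℂ)) ?_ (Set.infinite_range_of_injective fun m n e => by simpa using e))
    rintro _ ⟨n, rfl⟩
    obtain ⟨h1, h2, h3⟩ := h (n + 1) (by omega)
    rw [RatFunc.eval, RatFunc.eval, eval₂_id, eval₂_id, eval₂_id, eval₂_id,
      div_eq_div_iff h1 h2] at h3
    simpa only [Set.mem_ofPred_eq, eval_mul] using h3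
  rw [← RatFunc.num_div_denom r, ← RatFunc.num_div_denom s, div_eq_div_iff
    (RatFunc.algebraMap_ne_zero r.denom_ne_zero) (RatFunc.algebraMap_ne_zero s.denom_ne_zero),
    ← map_mul, ← map_mul, hp]

/-- The rational function `(n + c) / (n + c + e)`, with the factor `n` cancelled if
`c = e = 0`. -/
def shiftRatio (c e n : ℕ) : ℂ := if c + e = 0 then 1 else (n + c : ℂ) * ((n : ℂ) + (c + e : ℕ))⁻¹

theorem isRationalSeq_shiftRatio (c e : ℕ) : IsRationalSeq (shiftRatio c e) := by
  unfold shiftRatio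
  split_ifs with h
  · exact .const 1
  · exact (IsRationalSeq.natCast_add _).mul (IsRationalSeq.inv_natCast_add (Nat.pos_of_ne_zero h))

theorem shiftRatio_succ (c e n : ℕ) :
    shiftRatio c e (n + 1) = ((n + 1 : ℕ) + c : ℂ) * (((n + 1 : ℕ) : ℂ) + (c + e : ℕ))⁻¹ := by
  unfold shiftRatio
  split_ifs with h
  · obtain ⟨rfl, rfl⟩ : c = 0 ∧ e = 0 := by omega
    have : (n + 1 : ℂ) ≠ 0 := Nat.cast_add_one_ne_zero n
    simp [this]
  · rfl

/-- `n⁻¹ (D_n)_{ii} / (D_{n-1})_{ii}`. -/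
def diagRatio (N : ℕ) (a : ℝ) (lam i n : ℕ) : ℂ :=
  a * (n + (N + lam : ℕ)) * shiftRatio lam (N - (i + 1)) n * ((n : ℂ) + (N + lam - i : ℕ))⁻¹

/-- `n⁻¹ (D_n)_{ii} / (D_{n-1})_{i+1,i+1}`. -/
def offDiagRatio (N : ℕ) (a : ℝ) (lam i n : ℕ) : ℂ :=
  a * ((lam + N - (i + 1) : ℕ) * (i + 1 : ℕ)) * (n + (N + lam : ℕ)) *
    shiftRatio lam (N - (i + 2)) n * (((n : ℂ) + (N + lam - (i + 1) : ℕ))⁻¹ *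
      ((n : ℂ) + (N + lam - (i + 1) : ℕ))⁻¹ * ((n : ℂ) + (N + lam - i : ℕ))⁻¹)

theorem diagRatio_mul {N : ℕ} (a : ℝ) (lam n : ℕ) {i : ℕ} (hi : i < N) :
    ((n + 1 : ℕ) : ℂ) * diagRatio N a lam i (n + 1) * (normEntry N a lam n i : ℂ) =
      (normEntry N a lam (n + 1) i : ℂ) := by
  -- Parametrizing `N` by `q` turns every truncated subtraction into a sum.
  obtain ⟨q, rfl⟩ : ∃ q, N = i + 1 + q := ⟨N - (i + 1), by omega⟩
  rw [diagRatio, shiftRatio_succ, normEntry, normEntry,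
    show i + 1 + q + lam + (n + 1) - (i + 1) = q + lam + n + 1 by omega,
    show i + 1 + q + lam + (n + 1) - i = q + lam + n + 1 + 1 by omega,
    show i + 1 + q + lam + n - (i + 1) = q + lam + n by omega,
    show i + 1 + q + lam + n - i = q + lam + n + 1 by omega,
    show i + 1 + q - (i + 1) = q by omega, show i + 1 + q + lam - i = q + lam + 1 by omega,
    show i + 1 + q + lam + (n + 1) = i + 1 + q + lam + n + 1 by omega,
    ← add_assoc lam n 1, Nat.factorial_succ n, Nat.factorial_succ (i + 1 + q + lam + n),
    Nat.factorial_succ (lam + n), Nat.factorial_succ (q + lam + n + 1),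
    Nat.factorial_succ (q + lam + n)]
  have h1 := (q + lam + n).factorial_ne_zero
  have h2 := i.factorial_ne_zero
  have h3 : (n : ℂ) + 1 + (lam + q) ≠ 0 := by exact_mod_cast (by omega : n + 1 + (lam + q) ≠ 0)
  have h4 : (n : ℂ) + 1 + (q + lam + 1) ≠ 0 := by
    exact_mod_cast (by omega : n + 1 + (q + lam + 1) ≠ 0)
  have h5 : (q : ℂ) + lam + n + 1 ≠ 0 := by exact_mod_cast (by omega : q + lam + n + 1 ≠ 0)
  have h6 : (q : ℂ) + lam + n + 1 + 1 ≠ 0 := by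
    exact_mod_cast (by omega : q + lam + n + 1 + 1 ≠ 0)
  push_cast
  field_simp
  ring

theorem offDiagRatio_mul {N : ℕ} (a : ℝ) (lam n : ℕ) {i : ℕ} (hi : i + 1 < N) :
    ((n + 1 : ℕ) : ℂ) * offDiagRatio N a lam i (n + 1) * (normEntry N a lam n (i + 1) : ℂ) =
      (normEntry N a lam (n + 1) i : ℂ) := by
  obtain ⟨q, rfl⟩ : ∃ q, N = i + 2 + q := ⟨N - (i + 2), by omega⟩
  rw [offDiagRatio, shiftRatio_succ, normEntry, normEntry,
    show i + 2 + q + lam + (n + 1) - (i + 1) = q + lam + n + 1 + 1 by omega,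
    show i + 2 + q + lam + (n + 1) - i = q + lam + n + 1 + 1 + 1 by omega,
    show i + 2 + q + lam + n - (i + 1 + 1) = q + lam + n by omega,
    show i + 2 + q + lam + n - (i + 1) = q + lam + n + 1 by omega,
    show lam + (i + 2 + q) - (i + 1 + 1) = lam + q by omega,
    show lam + (i + 2 + q) - (i + 1) = lam + q + 1 by omega,
    show i + 2 + q - (i + 2) = q by omega, show i + 2 + q + lam - i = q + lam + 1 + 1 by omega,
    show i + 2 + q + lam - (i + 1) = q + lam + 1 by omega,
    show i + 2 + q + lam + (n + 1) = i + 2 + q + lam + n + 1 by omega,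
    ← add_assoc lam n 1, Nat.factorial_succ n, Nat.factorial_succ (i + 2 + q + lam + n),
    Nat.factorial_succ (lam + n), Nat.factorial_succ (q + lam + n + 1 + 1),
    Nat.factorial_succ (q + lam + n + 1), Nat.factorial_succ (q + lam + n),
    Nat.factorial_succ (lam + q), Nat.factorial_succ i]
  have h1 := (q + lam + n).factorial_ne_zero
  have h2 := i.factorial_ne_zero
  have h3 : (n : ℂ) + 1 + (lam + q) ≠ 0 := by exact_mod_cast (by omega : n + 1 + (lam + q) ≠ 0)
  have h4 : (n : ℂ) + 1 + (q + lam + 1) ≠ 0 := by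
    exact_mod_cast (by omega : n + 1 + (q + lam + 1) ≠ 0)
  have h4' : (n : ℂ) + 1 + (q + lam + 1 + 1) ≠ 0 := by
    exact_mod_cast (by omega : n + 1 + (q + lam + 1 + 1) ≠ 0)
  have h5 : (q : ℂ) + lam + n + 1 ≠ 0 := by exact_mod_cast (by omega : q + lam + n + 1 ≠ 0)
  have h6 : (q : ℂ) + lam + n + 1 + 1 ≠ 0 := by
    exact_mod_cast (by omega : q + lam + n + 1 + 1 ≠ 0)
  have h7 : (q : ℂ) + lam + n + 1 + 1 + 1 ≠ 0 := by
    exact_mod_cast (by omega : q + lam + n + 1 + 1 + 1 ≠ 0)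
  have h8 : (i : ℂ) + 1 ≠ 0 := Nat.cast_add_one_ne_zero i
  push_cast
  field_simp
  ring

/-- The rational extension of `D_n (1 + A^*) D_{n-1}⁻¹`. -/
def middle {N : ℕ} (a : ℝ) (μ : Fin N → ℝ) (lam n : ℕ) : Mat N :=
  Matrix.of fun i k => (n : ℂ) * (if i = k then diagRatio N a lam i n else
    (matA μ).conjTranspose i k * offDiagRatio N a lam i n)

theorem isRationalMatSeq_middle {N : ℕ} (a : ℝ) (μ : Fin N → ℝ) (lam : ℕ) :
    IsRationalMatSeq (middle a μ lam) := by
  intro i k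
  have hn : IsRationalSeq fun n => (n : ℂ) := by simpa using IsRationalSeq.natCast_add 0
  simp only [middle, Matrix.of_apply]
  refine hn.mul ?_
  by_cases h : i = k
  · simp only [if_pos h]
    exact (((IsRationalSeq.const _).mul (.natCast_add _)).mul (isRationalSeq_shiftRatio _ _)).mul
      (.inv_natCast_add (by omega))
  · simp only [if_neg h]
    by_cases hk : (k : ℕ) = i + 1
    · have h1 := IsRationalSeq.inv_natCast_add (c := N + lam - (i + 1)) (by omega)
      exact (IsRationalSeq.const _).mul ((((IsRationalSeq.const _).mul (.natCast_add _)).mul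
        (isRationalSeq_shiftRatio _ _)).mul ((h1.mul h1).mul (.inv_natCast_add (by omega))))
    · have h0 : (matA μ).conjTranspose i k = 0 := by
        rw [Matrix.conjTranspose_apply, matA, Matrix.of_apply, if_neg hk, star_zero]
      simp only [h0, zero_mul]
      exact .const 0

theorem middle_succ {N : ℕ} {a : ℝ} (ha : 0 < a) (μ : Fin N → ℝ) (lam n : ℕ) :
    middle a μ lam (n + 1) =
      matD N a lam (n + 1) * (1 + (matA μ).conjTranspose) * (matD N a lam n)⁻¹ := by
  have h : middle a μ lam (n + 1) * matD N a lam n =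
      matD N a lam (n + 1) * (1 + (matA μ).conjTranspose) := by
    rw [matD_eq, matD_eq]
    ext i k
    rw [Matrix.mul_diagonal, Matrix.diagonal_mul, Matrix.add_apply, middle, Matrix.of_apply]
    by_cases h : i = k
    · subst h
      have h0 : (matA μ).conjTranspose i i = 0 := by
        rw [Matrix.conjTranspose_apply, matA, Matrix.of_apply, if_neg (by omega), star_zero]
      rw [if_pos rfl, diagRatio_mul a lam n i.2, h0, Matrix.one_apply_eq, add_zero, mul_one]
    · rw [if_neg h, Matrix.one_apply_ne h, zero_add]
      by_cases hk : (k : ℕ) = i + 1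
      · rw [← offDiagRatio_mul a lam n (i := i) (by omega), hk]
        ring
      · have h0 : (matA μ).conjTranspose i k = 0 := by
          rw [Matrix.conjTranspose_apply, matA, Matrix.of_apply, if_neg hk, star_zero]
        rw [h0]
        ring
  rw [← h, Matrix.mul_nonsing_inv_cancel_right _ _
    ((Matrix.isUnit_iff_isUnit_det _).1 (posDef_matD ha lam n).isUnit)]

theorem exists_isRationalMatSeq_formulaC {N : ℕ} {a : ℝ} {μ : Fin N → ℝ} (ha : 0 < a)
    (hμ : ∀ j, 0 < μ j) (lam : ℕ) :
    ∃ M : ℕ → Mat N, IsRationalMatSeq M ∧ M 0 = 0 ∧ ∀ n, 1 ≤ n → M n = formulaC a μ lam n := by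
  have hu := (Matrix.isUnit_iff_isUnit_det _).1 (isUnit_one_add_matA hμ)
  -- The inverse is again unipotent, so its powers too are polynomial in the exponent.
  have hinv : (1 + matA μ)⁻¹ = 1 + -(matA μ * (1 + matA μ)⁻¹) := by
    have := Matrix.mul_nonsing_inv _ hu
    rw [add_mul, one_mul] at this
    rw [← sub_eq_add_neg, eq_sub_iff_add_eq, this]
  have hcomm : Commute (matA μ) (1 + matA μ)⁻¹ := by
    have h1 : matA μ * (1 + matA μ) = (1 + matA μ) * matA μ := by noncomm_ring
    calc matA μ * (1 + matA μ)⁻¹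
        = (1 + matA μ)⁻¹ * ((1 + matA μ) * matA μ) * (1 + matA μ)⁻¹ := by
          rw [← mul_assoc, Matrix.nonsing_inv_mul _ hu, one_mul]
      _ = (1 + matA μ)⁻¹ * matA μ := by
          rw [← h1, mul_assoc, mul_assoc, Matrix.mul_nonsing_inv _ hu, mul_one]
  have hnil : (-(matA μ * (1 + matA μ)⁻¹)) ^ N = 0 := by
    rw [neg_pow, hcomm.mul_pow, matA_pow_card hμ, zero_mul, mul_zero]
  have hrat : IsRationalMatSeq fun n => (1 + matA μ)⁻¹ ^ (n + lam) := by
    have := IsRationalMatSeq.one_add_pow hnil lam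
    rwa [← hinv] at this
  refine ⟨fun n => (matL0 a μ)⁻¹ * (1 + matA μ) ^ (n + lam) * middle a μ lam n *
    (1 + matA μ)⁻¹ ^ (n + lam) * (1 + matA μ) * matL0 a μ, ?_, ?_, ?_⟩
  · exact (((((IsRationalMatSeq.const _).mul (.one_add_pow (matA_pow_card hμ) lam)).mul
      (isRationalMatSeq_middle a μ lam)).mul hrat).mul (.const _)).mul (.const _)
  -- The factor `n` stands outside entries regular at `0`; the case `lam = 0`, where a denominator
  -- would also vanish there, was handled by the cancellation in `shiftRatio`.
  · have : middle a μ lam 0 = 0 := by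
      ext i k
      simp [middle]
    simp [this]
  · intro n hn
    obtain ⟨n, rfl⟩ : ∃ m, n = m + 1 := ⟨n - 1, by omega⟩
    dsimp only
    rw [formulaC, Nat.add_sub_cancel, middle_succ ha,
      show -((n + 1 : ℕ) : ℤ) - (lam : ℤ) + 1 = -((n + lam : ℕ) : ℤ) by push_cast; ring,
      zpow_neg_eq_inv_pow, mul_assoc _ (_⁻¹ ^ (n + 1 + lam)), show n + 1 + lam = n + lam + 1 by ring,
      pow_succ (_⁻¹), mul_assoc (_⁻¹ ^ _), Matrix.nonsing_inv_mul _ hu, mul_one]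
    simp only [mul_assoc]

end Rational

end

end MatrixCharlier

theorem theorem6p6 (N : ℕ) (hN : 0 < N) (a : ℝ) (ha : 0 < a)
    (μ : Fin N → ℝ) (hμ : ∀ j, 0 < μ j) (hμ' : MatrixCharlier.MuCondition a μ) (lam : ℕ) :
    -- the monic orthogonal polynomials exist and are unique
    (∃! P : ℕ → Polynomial (MatrixCharlier.Mat N),
      ∃ H : ℕ → MatrixCharlier.Mat N,
        MatrixCharlier.IsMonicOrthogonal (MatrixCharlier.weight a μ lam) P H) ∧
    ∀ (P : ℕ → Polynomial (MatrixCharlier.Mat N)) (H : ℕ → MatrixCharlier.Mat N),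
      MatrixCharlier.IsMonicOrthogonal (MatrixCharlier.weight a μ lam) P H →
      -- the matrices `D_n` are the diagonal factors of the square norms
      (∀ n, H n = (MatrixCharlier.matL0 a μ)⁻¹ * (1 + MatrixCharlier.matA μ) ^ (n + lam) *
        MatrixCharlier.matD N a lam n *
        (1 + (MatrixCharlier.matA μ).conjTranspose) ^ (n + lam) *
        ((MatrixCharlier.matL0 a μ).conjTranspose)⁻¹) ∧
      -- the three-term recurrence holds, and its coefficients are the explicit ones
      (∃ B C : ℕ → MatrixCharlier.Mat N, MatrixCharlier.IsThreeTermRecurrence P B C) ∧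
      ∀ B C : ℕ → MatrixCharlier.Mat N, MatrixCharlier.IsThreeTermRecurrence P B C →
        (∀ n, 1 ≤ n → C n = MatrixCharlier.formulaC a μ lam n) ∧
        (∀ n, B n = MatrixCharlier.formulaB a μ lam n) ∧
        -- `C_n`, `n ≥ 1`, extends to a unique rational function of `n`, which vanishes at `n = 0`
        (∃ R : Matrix (Fin N) (Fin N) (RatFunc ℂ),
          (∀ n : ℕ, 1 ≤ n → MatrixCharlier.HasValueAt R n (C n)) ∧
          MatrixCharlier.HasValueAt R 0 0 ∧
          ∀ R' : Matrix (Fin N) (Fin N) (RatFunc ℂ),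
            (∀ n : ℕ, 1 ≤ n → MatrixCharlier.HasValueAt R' n (C n)) → R' = R) := by
  open MatrixCharlier in
  have : NeZero N := ⟨hN.ne'⟩
  choose S hS using fun n => exists_isOrthogonal_weight ha hμ hμ' n lam
  have hW := isHermitian_weight a μ lam
  have hpos := posDef_squareNorm ha hμ lam
  refine ⟨⟨S, ⟨_, IsOrthogonal.isMonicOrthogonal hW hpos hS⟩, fun P ⟨H, h⟩ =>
    (h.eq_of_isOrthogonal hW hpos hS).1⟩, fun P H h => ?_⟩
  -- By uniqueness, any given sequence and its norms are the constructed ones.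
  obtain ⟨rfl, rfl⟩ := h.eq_of_isOrthogonal hW hpos hS
  refine ⟨squareNorm_eq hμ lam,
    ⟨_, _, IsOrthogonal.isThreeTermRecurrence hW hpos hS⟩, fun B C hBC => ?_⟩
  obtain ⟨hB, hC⟩ := hBC.eq hpos hS
  have hC' : ∀ n, 1 ≤ n → C n = formulaC a μ lam n := fun n hn => by
    obtain ⟨n, rfl⟩ : ∃ m, n = m + 1 := ⟨n - 1, by omega⟩
    rw [hC, ← formulaC_mul_squareNorm ha hμ, Matrix.mul_nonsing_inv_cancel_right _ _
      ((Matrix.isUnit_iff_isUnit_det _).1 (hpos n).isUnit)]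
  refine ⟨hC', fun n => (hB n).trans (coeff_sub_coeff_eq_formulaB ha hμ hμ' hS n), ?_⟩
  obtain ⟨M, hM, hM0, hMC⟩ := exists_isRationalMatSeq_formulaC ha hμ lam
  have hM' : ∀ i j, ∃ r : RatFunc ℂ, ∀ n : ℕ,
      r.denom.eval (n : ℂ) ≠ 0 ∧ r.eval (RingHom.id ℂ) n = M n i j := hM
  choose R hR using hM'
  refine ⟨Matrix.of R, fun n hn i j => ?_, fun i j => ?_, fun R' hR' => ?_⟩
  · rw [hC' n hn, ← hMC n hn]
    exact hR i j n
  -- The extension is regular on all of `ℕ`, so the same rational functions can be read off at `n =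
  -- 0`.
  · have := hR i j 0
    rwa [hM0, Nat.cast_zero] at this
  · ext i j
    refine RatFunc.eq_of_eval_natCast_eq fun n hn => ⟨(hR' n hn i j).1, (hR i j n).1, ?_⟩
    rw [(hR' n hn i j).2, Matrix.of_apply, (hR i j n).2, hMC n hn, hC' n hn]
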